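/- Let $(\mathbb C,\otimes,\mathbf 1)$ be a monoidal category, $(\mathbb E,\bullet,I)$ a monoidal category, and let $T$ be a bistrong graded monad on $\mathbb C$ with grades $\mathbb E$: a lax monoidal functor $T:\mathbb E\to[\mathbb C,\mathbb C]_{\mathrm{bistrong}}$, with multiplication $\phi_{e,e'}:T_e\circ T_{e'}\Rightarrow T_{e\bullet e'}$ and unit $\psi:\mathrm{id}\Rightarrow T_I$. Here $[\mathbb C,\mathbb C]_{\mathrm{bistrong}}$ is the category, monoidal under composition, of endofunctors $F$ of $\mathbb C$ with a left strength $t_{A,B}:A\otimes FB\to F(A\otimes B)$ and a right strength $s_{A,B}:FA\otimes B\to F(A\otimes B)$ for which the two canonical maps $(A\otimes FB)\otimes D\to F(A\otimes(B\otimes D))$ agree; its morphisms are the natural transformations commuting with both strengths. Let $\mathcal K_T$ be the following bicategory. Its objects are those of $\mathbb C$. A 1-cell $A\to B$ is a pair $(e,f)$ of a grade $e$ and a map $f:A\to T_eB$. A 2-cell $(e,f)\Rightarrow(e',f')$ is a map $\gamma:e\to e'$ of $\mathbb E$ with $(T_\gamma)_B\circ f=f'$. The composite of $(e,f):A\to B$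 and $(e',g):B\to D$ is $(e\bullet e',\ \phi_{e,e'}\circ T_e(g)\circ f)$, the identity on $A$ is $(I,\psi_A)$, and the structural 2-cells are those of $\mathbb E$. It is binoidal, with $A\rtimes(-)$ and $(-)\ltimes B$ given on objects by $\otimes$, on 1-cells by $$A\rtimes(e,g)=(e,\ t\circ(A\otimes g)),\qquad (e,f)\ltimes B=(e,\ s\circ(f\otimes B)),$$ on 2-cells by the same map of grades, and with unitors and compositors whose underlying maps of grades are identities. For a map $f:A\to B$ of $\mathbb C$ write $\tilde f=(I,\psi_B\circ f)$. A premonoidal structure on a binoidal bicategory consists of: a unit object; central 1-cells $\lambda_A,\rho_A,\alpha_{A,B,D}$ that are equivalences, $\lambda$ and $\rho$ being pseudonatural and $\alpha$ pseudonatural in each argument separately (a central 1-cell $f:A\to A'$ is one equipped with 2-cells making the families $f\ltimes X$ and $X\rtimes f$ pseudonatural in $X$); and invertible 2-cells $$\mathfrak p:(\alpha_{A,B,D}\ltimes X)\,;\,\alpha_{A,BD,X}\,;\,(A\rtimes\alpha_{B,D,X})\Rightarrow\alpha_{AB,D,X}\,;\,\alpha_{A,B,DX},\qquad \mathfrak m:\alpha_{A,\mathbf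 1,B}\,;\,(A\rtimes\lambda_B)\Rightarrow\rho_A\ltimes B,$$ $$\mathfrak l:\lambda_A\ltimes B\Rightarrow\alpha_{\mathbf 1,A,B}\,;\,\lambda_{AB},\qquad \mathfrak r:\rho_{AB}\Rightarrow\alpha_{A,B,\mathbf 1}\,;\,(A\rtimes\rho_B)$$ (with $;$ denoting composition in diagrammatic order and juxtaposition the joint value of $\rtimes$ and $\ltimes$ on objects), which are modifications in each argument separately (using the centrality 2-cells of $\alpha,\lambda,\rho$ where interchange 2-cells would be used in a monoidal bicategory) and satisfy the three equations of a monoidal bicategory (the associahedron equation and the left and right normalisation equations). Then $\mathcal K_T$ has a canonical premonoidal structure: its unit object is $\mathbf 1$; its structural 1-cells are $\tilde\alpha,\tilde\lambda,\tilde\rho$, the lifts of the structural isomorphisms of $\mathbb C$, with inverse equivalences the lifts of the inverse isomorphisms; all pseudonaturality and centrality 2-cells at a 1-cell of grade $e$ have as underlying map of grades the canonical isomorphism $e\bullet I\to I\bullet e$; and $\mathfrak p,\mathfrak m,\mathfrak l,\mathfrak r$ are given by the canonical isomorphisms $I\bullet(I\bullet I)\to I\bullet I$, $I\bullet I\to I$,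 $I\to I\bullet I$ and $I\to I\bullet I$ of $\mathbb E$. Moreover, this structure can be chosen such that, if $\mathbb E$ is strict monoidal, it is strict: every pseudofunctor $A\rtimes(-)$ and $(-)\ltimes B$ is strict (its unitors and compositors are identity 2-cells), and all structural 2-cells (the pseudonaturality and centrality 2-cells of $\alpha,\lambda,\rho$, the unit and counit 2-cells of the equivalences, and the components of $\mathfrak p,\mathfrak m,\mathfrak l,\mathfrak r$) are identities. -/

import Mathlib

open CategoryTheory

universe w v u w' v' u' v₁ v₂ u₁ u₂

/-! ### Identities -/

/-- An isomorphism between two objects that are equal, given by the identity. In a bicategory this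
is applied to invertible 2-cells, seen as isomorphisms between 1-cells. -/
def IsIdentity {X : Type u} [Category.{v} X] {x y : X} (φ : x ≅ y) : Prop :=
  ∃ h : x = y, φ = eqToIso h

/-- A strict monoidal category: all the structural isomorphisms are identities. -/
structure IsStrictMonoidal (E : Type u) [Category.{v} E] [MonoidalCategory E] : Prop where
  associator : ∀ X Y Z : E, IsIdentity (MonoidalCategory.associator X Y Z)
  leftUnitor : ∀ X : E, IsIdentity (MonoidalCategory.leftUnitor X)
  rightUnitor : ∀ X : E, IsIdentity (MonoidalCategory.rightUnitor X)

/-! ### Pseudofunctors, pseudonatural transformations and equivalences -/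

section Bicat

open Bicategory

/-- A pseudofunctor with a prescribed action `o` on objects. -/
structure PseudofunctorOn (B : Type u) [Bicategory.{w, v} B] (D : Type u') [Bicategory.{w', v'} D]
    (o : B → D) where
  map {a b : B} (f : a ⟶ b) : o a ⟶ o b
  map₂ {a b : B} {f g : a ⟶ b} (η : f ⟶ g) : map f ⟶ map g
  mapId (a : B) : map (𝟙 a) ≅ 𝟙 (o a)
  mapComp {a b c : B} (f : a ⟶ b) (g : b ⟶ c) : map (f ≫ g) ≅ map f ≫ map g
  map₂_id : ∀ {a b : B} (f : a ⟶ b), map₂ (𝟙 f) = 𝟙 (map f)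
  map₂_comp : ∀ {a b : B} {f g h : a ⟶ b} (η : f ⟶ g) (θ : g ⟶ h),
    map₂ (η ≫ θ) = map₂ η ≫ map₂ θ
  map₂_whisker_left : ∀ {a b c : B} (f : a ⟶ b) {g h : b ⟶ c} (η : g ⟶ h),
    map₂ (f ◁ η) = (mapComp f g).hom ≫ map f ◁ map₂ η ≫ (mapComp f h).inv
  map₂_whisker_right : ∀ {a b c : B} {f g : a ⟶ b} (η : f ⟶ g) (h : b ⟶ c),
    map₂ (η ▷ h) = (mapComp f h).hom ≫ map₂ η ▷ map h ≫ (mapComp g h).inv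
  map₂_associator : ∀ {a b c d : B} (f : a ⟶ b) (g : b ⟶ c) (h : c ⟶ d),
    map₂ (α_ f g h).hom = (mapComp (f ≫ g) h).hom ≫ (mapComp f g).hom ▷ map h ≫
      (α_ (map f) (map g) (map h)).hom ≫ map f ◁ (mapComp g h).inv ≫ (mapComp f (g ≫ h)).inv
  map₂_left_unitor : ∀ {a b : B} (f : a ⟶ b),
    map₂ (λ_ f).hom = (mapComp (𝟙 a) f).hom ≫ (mapId a).hom ▷ map f ≫ (λ_ (map f)).hom
  map₂_right_unitor : ∀ {a b : B} (f : a ⟶ b),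
    map₂ (ρ_ f).hom = (mapComp f (𝟙 b)).hom ≫ map f ◁ (mapId b).hom ≫ (ρ_ (map f)).hom

/-- The underlying pseudofunctor. -/
abbrev PseudofunctorOn.toPseudofunctor {B : Type u} [Bicategory.{w, v} B] {D : Type u'}
    [Bicategory.{w', v'} D] {o : B → D} (F : PseudofunctorOn B D o) : Pseudofunctor B D where
  obj := o
  map f := F.map f
  map₂ η := F.map₂ η
  map₂_id f := F.map₂_id f
  map₂_comp η θ := F.map₂_comp η θ
  mapId a := F.mapId a
  mapComp f g := F.mapComp f g
  map₂_whisker_left f _ _ η := F.map₂_whisker_left f η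
  map₂_whisker_right η h := F.map₂_whisker_right η h
  map₂_associator f g h := F.map₂_associator f g h
  map₂_left_unitor f := F.map₂_left_unitor f
  map₂_right_unitor f := F.map₂_right_unitor f

/-- A strict pseudofunctor: the unitors and compositors are identities. -/
def IsStrictPseudofunctor {B : Type u} [Bicategory.{w, v} B] {D : Type u'}
    [Bicategory.{w', v'} D] (F : Pseudofunctor B D) : Prop :=
  (∀ a : B, IsIdentity (F.mapId a)) ∧
    ∀ {a b c : B} (f : a ⟶ b) (g : b ⟶ c), IsIdentity (F.mapComp f g)

/-- Pseudonaturality data for a prescribed family `app` of 1-cells `F a ⟶ G a`: the invertible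
2-cells and the axioms that make `app` a pseudonatural transformation `F ⟹ G`. -/
structure Pseudonat {B : Type u} [Bicategory.{w, v} B] {D : Type u'} [Bicategory.{w', v'} D]
    (F G : Pseudofunctor B D) (app : ∀ a : B, F.obj a ⟶ G.obj a) where
  cell {a b : B} (f : a ⟶ b) : F.map f ≫ app b ≅ app a ≫ G.map f
  naturality : ∀ {a b : B} {f g : a ⟶ b} (η : f ⟶ g),
    F.map₂ η ▷ app b ≫ (cell g).hom = (cell f).hom ≫ app a ◁ G.map₂ η
  cell_id : ∀ a : B, (cell (𝟙 a)).hom ≫ app a ◁ (G.mapId a).hom =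
    (F.mapId a).hom ▷ app a ≫ (λ_ (app a)).hom ≫ (ρ_ (app a)).inv
  cell_comp : ∀ {a b c : B} (f : a ⟶ b) (g : b ⟶ c),
    (cell (f ≫ g)).hom ≫ app a ◁ (G.mapComp f g).hom =
      (F.mapComp f g).hom ▷ app c ≫ (α_ _ _ _).hom ≫ F.map f ◁ (cell g).hom ≫
        (α_ _ _ _).inv ≫ (cell f).hom ▷ G.map g ≫ (α_ _ _ _).hom

/-- The pseudonatural transformation given by `app` and its pseudonaturality data. -/
def Pseudonat.toStrongTrans {B : Type u} [Bicategory.{w, v} B] {D : Type u'}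
    [Bicategory.{w', v'} D] {F G : Pseudofunctor B D} {app : ∀ a : B, F.obj a ⟶ G.obj a}
    (η : Pseudonat F G app) : Pseudofunctor.StrongTrans F G where
  app := app
  naturality f := η.cell f
  naturality_naturality σ := η.naturality σ
  naturality_id a := η.cell_id a
  naturality_comp f g := η.cell_comp f g

variable {B : Type u} [Bicategory.{w, v} B]

/-- The structure of an equivalence on a 1-cell. -/
structure EquivalenceData {a b : B} (f : a ⟶ b) where
  inv : b ⟶ a
  unit : 𝟙 a ≅ f ≫ inv
  counit : inv ≫ f ≅ 𝟙 b

/-! ### Pasting of naturality squares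

The pseudonaturality 2-cells of composites of pseudonatural transformations, and of the image of a
pseudonatural transformation under a pseudofunctor. -/

/-- Pasting of two squares: the 2-cell of a vertical composite of pseudonatural transformations. -/
def pasteSq {a a' b b' d d' : B} {p : a ⟶ a'} {q : b ⟶ b'} {r : d ⟶ d'} {x : a ⟶ b} {x' : a' ⟶ b'}
    {y : b ⟶ d} {y' : b' ⟶ d'} (N : p ≫ x' ≅ x ≫ q) (N' : q ≫ y' ≅ y ≫ r) :
    p ≫ (x' ≫ y') ≅ (x ≫ y) ≫ r :=
  (α_ p x' y').symm ≪≫ whiskerRightIso N y' ≪≫ α_ x q y' ≪≫ whiskerLeftIso x N' ≪≫ (α_ x y r).symm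

/-- The image of a square under a pseudofunctor. -/
def mapSq (K : Pseudofunctor B B) {a a' b b' : B} {p : a ⟶ a'} {q : b ⟶ b'} {x : a ⟶ b}
    {x' : a' ⟶ b'} (N : p ≫ x' ≅ x ≫ q) : K.map p ≫ K.map x' ≅ K.map x ≫ K.map q :=
  (K.mapComp p x').symm ≪≫ K.map₂Iso N ≪≫ K.mapComp x q

/-- The image under a pseudofunctor of a 2-cell between composites of two and one 1-cells. -/
def map21 (K : Pseudofunctor B B) {a b c : B} {x : a ⟶ b} {y : b ⟶ c} {z : a ⟶ c}
    (N : x ≫ y ≅ z) : K.map x ≫ K.map y ≅ K.map z :=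
  (K.mapComp x y).symm ≪≫ K.map₂Iso N

/-- The image under a pseudofunctor of a 2-cell between composites of three and two 1-cells. -/
def map32 (K : Pseudofunctor B B) {a b b' c d : B} {x : a ⟶ b} {y : b ⟶ c} {z : c ⟶ d}
    {x' : a ⟶ b'} {y' : b' ⟶ d} (N : x ≫ (y ≫ z) ≅ x' ≫ y') :
    K.map x ≫ (K.map y ≫ K.map z) ≅ K.map x' ≫ K.map y' :=
  whiskerLeftIso (K.map x) (K.mapComp y z).symm ≪≫ (K.mapComp x (y ≫ z)).symm ≪≫ K.map₂Iso N ≪≫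
    K.mapComp x' y'

/-- The modification axiom at the 1-cells `p`, `q` (the images of a given 1-cell under the source
and the target pseudofunctor), for 2-cells `Γ`, `Γ'` between the components `x ⟹ y`, `x' ⟹ y'` of
two pseudonatural transformations with naturality 2-cells `N`, `N'`. -/
def ModificationAt {a a' b b' : B} {p : a ⟶ a'} {q : b ⟶ b'} {x y : a ⟶ b} {x' y' : a' ⟶ b'}
    (N : p ≫ x' ≅ x ≫ q) (N' : p ≫ y' ≅ y ≫ q) (Γ : x ≅ y) (Γ' : x' ≅ y') : Prop :=
  p ◁ Γ'.hom ≫ N'.hom = N.hom ≫ Γ.hom ▷ q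

end Bicat

/-! ### Binoidal bicategories -/

/-- A binoidal bicategory: pseudofunctors `A ⋊ (-)` and `(-) ⋉ X` for all objects `A`, `X`, with
a joint value `A ⊙ X` on objects. -/
class BinoidalBicategory (B : Type u) [Bicategory.{w, v} B] where
  tensorObj : B → B → B
  leftOn (A : B) : PseudofunctorOn B B (fun X => tensorObj A X)
  rightOn (X : B) : PseudofunctorOn B B (fun A => tensorObj A X)

section Premonoidal

open Bicategory

variable {B : Type u} [Bicategory.{w, v} B] [BinoidalBicategory B]

/-- The pseudofunctor `A ⋊ (-)`. -/
abbrev leftAct (A : B) : Pseudofunctor B B := (BinoidalBicategory.leftOn A).toPseudofunctor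

/-- The pseudofunctor `(-) ⋉ X`. -/
abbrev rightAct (X : B) : Pseudofunctor B B := (BinoidalBicategory.rightOn X).toPseudofunctor

/-- The 1-cell `A ⋊ g`. -/
abbrev ltMap (A : B) {X X' : B} (g : X ⟶ X') :
    BinoidalBicategory.tensorObj A X ⟶ BinoidalBicategory.tensorObj A X' := (leftAct A).map g

/-- The 1-cell `f ⋉ X`. -/
abbrev rtMap {A A' : B} (f : A ⟶ A') (X : B) :
    BinoidalBicategory.tensorObj A X ⟶ BinoidalBicategory.tensorObj A' X := (rightAct X).map f

infixl:95 " ⊙ " => BinoidalBicategory.tensorObj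
infixr:90 " ⋊ " => ltMap
infixl:90 " ⋉ " => rtMap

/-- The structure of a central 1-cell on `f : A ⟶ A'`. -/
structure CentralData {A A' : B} (f : A ⟶ A') where
  lc : Pseudonat (leftAct A) (leftAct A') (fun X => f ⋉ X)
  rc : Pseudonat (rightAct A) (rightAct A') (fun X => X ⋊ f)

/-- The unit object and the 1-cells of a premonoidal bicategory: the components of the associator
and of the two unitors. -/
structure PremonoidalCells (B : Type u) [Bicategory.{w, v} B] [BinoidalBicategory B] where
  unit : B
  assoc (A X Y : B) : (A ⊙ X) ⊙ Y ⟶ A ⊙ (X ⊙ Y)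
  lam (A : B) : unit ⊙ A ⟶ A
  rho (A : B) : A ⊙ unit ⟶ A

/-- The data of a premonoidal bicategory with given unit and structural 1-cells. -/
structure PremonoidalData (S : PremonoidalCells B) where
  /-- the left unitor is a pseudonatural equivalence with central components -/
  lamNat : Pseudonat (leftAct S.unit) (Pseudofunctor.id B) S.lam
  lamEquiv (A : B) : EquivalenceData (S.lam A)
  lamCentral (A : B) : CentralData (S.lam A)
  /-- the right unitor is a pseudonatural equivalence with central components -/
  rhoNat : Pseudonat (rightAct S.unit) (Pseudofunctor.id B) S.rho
  rhoEquiv (A : B) : EquivalenceData (S.rho A)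
  rhoCentral (A : B) : CentralData (S.rho A)
  /-- the associator is pseudonatural in each argument, its components are central equivalences -/
  assocNat₁ (X Y : B) : Pseudonat ((rightAct X).comp (rightAct Y)) (rightAct (X ⊙ Y)) (fun A => S.assoc A X Y)
  assocNat₂ (A Y : B) :
    Pseudonat ((leftAct A).comp (rightAct Y)) ((rightAct Y).comp (leftAct A)) (fun X => S.assoc A X Y)
  assocNat₃ (A X : B) : Pseudonat (leftAct (A ⊙ X)) ((leftAct X).comp (leftAct A)) (fun Y => S.assoc A X Y)
  assocEquiv (A X Y : B) : EquivalenceData (S.assoc A X Y)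
  assocCentral (A X Y : B) : CentralData (S.assoc A X Y)
  /-- the structural 2-cells -/
  p (A X Y Z : B) : S.assoc A X Y ⋉ Z ≫ (S.assoc A (X ⊙ Y) Z ≫ A ⋊ S.assoc X Y Z) ≅
    S.assoc (A ⊙ X) Y Z ≫ S.assoc A X (Y ⊙ Z)
  m (A X : B) : S.assoc A S.unit X ≫ A ⋊ S.lam X ≅ S.rho A ⋉ X
  l (A X : B) : S.lam A ⋉ X ≅ S.assoc S.unit A X ≫ S.lam (A ⊙ X)
  r (A X : B) : S.rho (A ⊙ X) ≅ S.assoc A X S.unit ≫ A ⋊ S.rho X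

namespace PremonoidalData

variable {S : PremonoidalCells B} (P : PremonoidalData S)

/-! The naturality 2-cells of the structural 1-cells. -/

def lamC {A A' : B} (f : A ⟶ A') : S.unit ⋊ f ≫ S.lam A' ≅ S.lam A ≫ f :=
  P.lamNat.cell f

def rhoC {A A' : B} (f : A ⟶ A') : f ⋉ S.unit ≫ S.rho A' ≅ S.rho A ≫ f :=
  P.rhoNat.cell f

def assoc₁ {A A' : B} (f : A ⟶ A') (X Y : B) :
    f ⋉ X ⋉ Y ≫ S.assoc A' X Y ≅ S.assoc A X Y ≫ f ⋉ (X ⊙ Y) :=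
  (P.assocNat₁ X Y).cell f

def assoc₂ (A : B) {X X' : B} (g : X ⟶ X') (Y : B) :
    (A ⋊ g) ⋉ Y ≫ S.assoc A X' Y ≅ S.assoc A X Y ≫ A ⋊ (g ⋉ Y) :=
  (P.assocNat₂ A Y).cell g

def assoc₃ (A X : B) {Y Y' : B} (h : Y ⟶ Y') :
    (A ⊙ X) ⋊ h ≫ S.assoc A X Y' ≅ S.assoc A X Y ≫ A ⋊ X ⋊ h :=
  (P.assocNat₃ A X).cell h

end PremonoidalData

/-- The left centrality 2-cell of `f` at `g`. -/
def CentralData.lcAt {A A' : B} {f : A ⟶ A'} (c : CentralData f) {X X' : B} (g : X ⟶ X') :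
    A ⋊ g ≫ f ⋉ X' ≅ f ⋉ X ≫ A' ⋊ g :=
  c.lc.cell g

/-- The right centrality 2-cell of `f` at `g`. -/
def CentralData.rcAt {A A' : B} {f : A ⟶ A'} (c : CentralData f) {X X' : B} (g : X ⟶ X') :
    g ⋉ A ≫ X' ⋊ f ≅ X ⋊ f ≫ g ⋉ A' :=
  c.rc.cell g

/-- A premonoidal structure on a binoidal bicategory, with given unit and structural 1-cells: the
structural 2-cells `p`, `m`, `l`, `r` are modifications in each argument, and satisfy the
equations of a monoidal bicategory. -/
structure PremonoidalStructure (S : PremonoidalCells B) extends PremonoidalData S where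
  p_mod₁ : ∀ {A A' : B} (f : A ⟶ A') (X Y Z : B),
    ModificationAt
      (pasteSq (mapSq (rightAct Z) (toPremonoidalData.assoc₁ f X Y))
        (pasteSq (toPremonoidalData.assoc₁ f (X ⊙ Y) Z) ((assocCentral X Y Z).rcAt f)))
      (pasteSq (toPremonoidalData.assoc₁ (f ⋉ X) Y Z) (toPremonoidalData.assoc₁ f X (Y ⊙ Z)))
      (p A X Y Z) (p A' X Y Z)
  p_mod₂ : ∀ (A : B) {X X' : B} (f : X ⟶ X') (Y Z : B),
    ModificationAt
      (pasteSq (mapSq (rightAct Z) (toPremonoidalData.assoc₂ A f Y))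
        (pasteSq (toPremonoidalData.assoc₂ A (f ⋉ Y) Z)
          (mapSq (leftAct A) (toPremonoidalData.assoc₁ f Y Z))))
      (pasteSq (toPremonoidalData.assoc₁ (A ⋊ f) Y Z) (toPremonoidalData.assoc₂ A f (Y ⊙ Z)))
      (p A X Y Z) (p A X' Y Z)
  p_mod₃ : ∀ (A X : B) {Y Y' : B} (f : Y ⟶ Y') (Z : B),
    ModificationAt
      (pasteSq (mapSq (rightAct Z) (toPremonoidalData.assoc₃ A X f))
        (pasteSq (toPremonoidalData.assoc₂ A (X ⋊ f) Z)
          (mapSq (leftAct A) (toPremonoidalData.assoc₂ X f Z))))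
      (pasteSq (toPremonoidalData.assoc₂ (A ⊙ X) f Z) (toPremonoidalData.assoc₃ A X (f ⋉ Z)))
      (p A X Y Z) (p A X Y' Z)
  p_mod₄ : ∀ (A X Y : B) {Z Z' : B} (f : Z ⟶ Z'),
    ModificationAt
      (pasteSq ((assocCentral A X Y).lcAt f)
        (pasteSq (toPremonoidalData.assoc₃ A (X ⊙ Y) f)
          (mapSq (leftAct A) (toPremonoidalData.assoc₃ X Y f))))
      (pasteSq (toPremonoidalData.assoc₃ (A ⊙ X) Y f) (toPremonoidalData.assoc₃ A X (Y ⋊ f)))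
      (p A X Y Z) (p A X Y Z')
  m_mod₁ : ∀ {A A' : B} (f : A ⟶ A') (X : B),
    ModificationAt
      (pasteSq (toPremonoidalData.assoc₁ f S.unit X) ((lamCentral X).rcAt f))
      (mapSq (rightAct X) (toPremonoidalData.rhoC f))
      (m A X) (m A' X)
  m_mod₂ : ∀ (A : B) {X X' : B} (f : X ⟶ X'),
    ModificationAt
      (pasteSq (toPremonoidalData.assoc₃ A S.unit f) (mapSq (leftAct A) (toPremonoidalData.lamC f)))
      ((rhoCentral A).lcAt f)
      (m A X) (m A X')
  l_mod₁ : ∀ {A A' : B} (f : A ⟶ A') (X : B),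
    ModificationAt
      (mapSq (rightAct X) (toPremonoidalData.lamC f))
      (pasteSq (toPremonoidalData.assoc₂ S.unit f X) (toPremonoidalData.lamC (f ⋉ X)))
      (l A X) (l A' X)
  l_mod₂ : ∀ (A : B) {X X' : B} (f : X ⟶ X'),
    ModificationAt
      ((lamCentral A).lcAt f)
      (pasteSq (toPremonoidalData.assoc₃ S.unit A f) (toPremonoidalData.lamC (A ⋊ f)))
      (l A X) (l A X')
  r_mod₁ : ∀ {A A' : B} (f : A ⟶ A') (X : B),
    ModificationAt
      (toPremonoidalData.rhoC (f ⋉ X))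
      (pasteSq (toPremonoidalData.assoc₁ f X S.unit) ((rhoCentral X).rcAt f))
      (r A X) (r A' X)
  r_mod₂ : ∀ (A : B) {X X' : B} (f : X ⟶ X'),
    ModificationAt
      (toPremonoidalData.rhoC (A ⋊ f))
      (pasteSq (toPremonoidalData.assoc₂ A f S.unit) (mapSq (leftAct A) (toPremonoidalData.rhoC f)))
      (r A X) (r A X')
  /-- The non-abelian 4-cocycle (associahedron) equation. -/
  cocycle : ∀ A X Y Z W : B,
    𝟙 (S.assoc A X Y ⋉ Z ⋉ W ≫ S.assoc A (X ⊙ Y) Z ⋉ W ≫ (A ⋊ S.assoc X Y Z) ⋉ W ≫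
        S.assoc A (X ⊙ (Y ⊙ Z)) W ≫ A ⋊ S.assoc X (Y ⊙ Z) W ≫ A ⋊ X ⋊ S.assoc Y Z W) ⊗≫
      (map32 (rightAct W) (p A X Y Z)).hom ▷
        (S.assoc A (X ⊙ (Y ⊙ Z)) W ≫ A ⋊ S.assoc X (Y ⊙ Z) W ≫ A ⋊ X ⋊ S.assoc Y Z W) ⊗≫
      S.assoc (A ⊙ X) Y Z ⋉ W ◁ (p A X (Y ⊙ Z) W).hom ▷ (A ⋊ X ⋊ S.assoc Y Z W) ⊗≫
      (S.assoc (A ⊙ X) Y Z ⋉ W ≫ S.assoc (A ⊙ X) (Y ⊙ Z) W) ◁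
        (toPremonoidalData.assoc₃ A X (S.assoc Y Z W)).inv ⊗≫
      (p (A ⊙ X) Y Z W).hom ▷ S.assoc A X (Y ⊙ (Z ⊙ W)) ⊗≫
      𝟙 (S.assoc (A ⊙ X ⊙ Y) Z W ≫ S.assoc (A ⊙ X) Y (Z ⊙ W) ≫ S.assoc A X (Y ⊙ (Z ⊙ W))) =
    𝟙 (S.assoc A X Y ⋉ Z ⋉ W ≫ S.assoc A (X ⊙ Y) Z ⋉ W ≫ (A ⋊ S.assoc X Y Z) ⋉ W ≫
        S.assoc A (X ⊙ (Y ⊙ Z)) W ≫ A ⋊ S.assoc X (Y ⊙ Z) W ≫ A ⋊ X ⋊ S.assoc Y Z W) ⊗≫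
      (S.assoc A X Y ⋉ Z ⋉ W ≫ S.assoc A (X ⊙ Y) Z ⋉ W) ◁
        (toPremonoidalData.assoc₂ A (S.assoc X Y Z) W).hom ▷
          (A ⋊ S.assoc X (Y ⊙ Z) W ≫ A ⋊ X ⋊ S.assoc Y Z W) ⊗≫
      (S.assoc A X Y ⋉ Z ⋉ W ≫ S.assoc A (X ⊙ Y) Z ⋉ W ≫ S.assoc A (X ⊙ Y ⊙ Z) W) ◁
        (map32 (leftAct A) (p X Y Z W)).hom ⊗≫
      S.assoc A X Y ⋉ Z ⋉ W ◁ (p A (X ⊙ Y) Z W).hom ▷ (A ⋊ S.assoc X Y (Z ⊙ W)) ⊗≫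
      (toPremonoidalData.assoc₁ (S.assoc A X Y) Z W).hom ▷
        (S.assoc A (X ⊙ Y) (Z ⊙ W) ≫ A ⋊ S.assoc X Y (Z ⊙ W)) ⊗≫
      S.assoc (A ⊙ X ⊙ Y) Z W ◁ (p A X Y (Z ⊙ W)).hom ⊗≫
      𝟙 (S.assoc (A ⊙ X ⊙ Y) Z W ≫ S.assoc (A ⊙ X) Y (Z ⊙ W) ≫ S.assoc A X (Y ⊙ (Z ⊙ W)))
  /-- The left normalisation equation. -/
  norm_left : ∀ A X Y : B,
    𝟙 (S.assoc A S.unit X ⋉ Y ≫ S.assoc A (S.unit ⊙ X) Y ≫ A ⋊ S.assoc S.unit X Y ≫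
        A ⋊ S.lam (X ⊙ Y)) ⊗≫
      (p A S.unit X Y).hom ▷ (A ⋊ S.lam (X ⊙ Y)) ⊗≫
      S.assoc (A ⊙ S.unit) X Y ◁ (m A (X ⊙ Y)).hom ⊗≫
      𝟙 (S.assoc (A ⊙ S.unit) X Y ≫ S.rho A ⋉ (X ⊙ Y)) =
    𝟙 (S.assoc A S.unit X ⋉ Y ≫ S.assoc A (S.unit ⊙ X) Y ≫ A ⋊ S.assoc S.unit X Y ≫
        A ⋊ S.lam (X ⊙ Y)) ⊗≫
      (S.assoc A S.unit X ⋉ Y ≫ S.assoc A (S.unit ⊙ X) Y) ◁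
        (map21 (leftAct A) (l X Y).symm).hom ⊗≫
      S.assoc A S.unit X ⋉ Y ◁ (toPremonoidalData.assoc₂ A (S.lam X) Y).inv ⊗≫
      (map21 (rightAct Y) (m A X)).hom ▷ S.assoc A X Y ⊗≫
      (toPremonoidalData.assoc₁ (S.rho A) X Y).hom ⊗≫
      𝟙 (S.assoc (A ⊙ S.unit) X Y ≫ S.rho A ⋉ (X ⊙ Y))
  /-- The right normalisation equation. -/
  norm_right : ∀ A X Y : B,
    𝟙 (S.assoc A X S.unit ⋉ Y ≫ S.assoc A (X ⊙ S.unit) Y ≫ A ⋊ S.assoc X S.unit Y ≫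
        A ⋊ X ⋊ S.lam Y) ⊗≫
      (p A X S.unit Y).hom ▷ (A ⋊ X ⋊ S.lam Y) ⊗≫
      S.assoc (A ⊙ X) S.unit Y ◁ (toPremonoidalData.assoc₃ A X (S.lam Y)).inv ⊗≫
      (m (A ⊙ X) Y).hom ▷ S.assoc A X Y ⊗≫
      𝟙 (S.rho (A ⊙ X) ⋉ Y ≫ S.assoc A X Y) =
    𝟙 (S.assoc A X S.unit ⋉ Y ≫ S.assoc A (X ⊙ S.unit) Y ≫ A ⋊ S.assoc X S.unit Y ≫
        A ⋊ X ⋊ S.lam Y) ⊗≫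
      (S.assoc A X S.unit ⋉ Y ≫ S.assoc A (X ⊙ S.unit) Y) ◁ (map21 (leftAct A) (m X Y)).hom ⊗≫
      S.assoc A X S.unit ⋉ Y ◁ (toPremonoidalData.assoc₂ A (S.rho X) Y).inv ⊗≫
      (map21 (rightAct Y) (r A X).symm).hom ▷ S.assoc A X Y ⊗≫
      𝟙 (S.rho (A ⊙ X) ⋉ Y ≫ S.assoc A X Y)

/-- A strict premonoidal structure: the pseudofunctors `A ⋊ (-)` and `(-) ⋉ X` are strict, and all
the structural 2-cells (naturality, centrality, equivalence and modification 2-cells) are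
identities. -/
structure PremonoidalStructure.IsStrict {S : PremonoidalCells B} (P : PremonoidalStructure S) :
    Prop where
  left : ∀ A : B, IsStrictPseudofunctor (leftAct A)
  right : ∀ X : B, IsStrictPseudofunctor (rightAct X)
  lam : ∀ {A A' : B} (f : A ⟶ A'), IsIdentity (P.lamC f)
  rho : ∀ {A A' : B} (f : A ⟶ A'), IsIdentity (P.rhoC f)
  assoc₁ : ∀ {A A' : B} (f : A ⟶ A') (X Y : B), IsIdentity (P.assoc₁ f X Y)
  assoc₂ : ∀ (A : B) {X X' : B} (f : X ⟶ X') (Y : B), IsIdentity (P.assoc₂ A f Y)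
  assoc₃ : ∀ (A X : B) {Y Y' : B} (f : Y ⟶ Y'), IsIdentity (P.assoc₃ A X f)
  lam_lc : ∀ (A : B) {X X' : B} (f : X ⟶ X'), IsIdentity ((P.lamCentral A).lcAt f)
  lam_rc : ∀ (A : B) {X X' : B} (f : X ⟶ X'), IsIdentity ((P.lamCentral A).rcAt f)
  rho_lc : ∀ (A : B) {X X' : B} (f : X ⟶ X'), IsIdentity ((P.rhoCentral A).lcAt f)
  rho_rc : ∀ (A : B) {X X' : B} (f : X ⟶ X'), IsIdentity ((P.rhoCentral A).rcAt f)
  assoc_lc : ∀ (A X Y : B) {Z Z' : B} (f : Z ⟶ Z'), IsIdentity ((P.assocCentral A X Y).lcAt f)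
  assoc_rc : ∀ (A X Y : B) {Z Z' : B} (f : Z ⟶ Z'), IsIdentity ((P.assocCentral A X Y).rcAt f)
  lam_equiv : ∀ A : B, IsIdentity (P.lamEquiv A).unit ∧ IsIdentity (P.lamEquiv A).counit
  rho_equiv : ∀ A : B, IsIdentity (P.rhoEquiv A).unit ∧ IsIdentity (P.rhoEquiv A).counit
  assoc_equiv : ∀ A X Y : B,
    IsIdentity (P.assocEquiv A X Y).unit ∧ IsIdentity (P.assocEquiv A X Y).counit
  p : ∀ A X Y Z : B, IsIdentity (P.p A X Y Z)
  m : ∀ A X : B, IsIdentity (P.m A X)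
  l : ∀ A X : B, IsIdentity (P.l A X)
  r : ∀ A X : B, IsIdentity (P.r A X)

end Premonoidal

/-! ### Bistrong graded monads -/

section Graded

open MonoidalCategory

/-- A bistrong endofunctor of a monoidal category: an endofunctor with a left strength `t`, a right
strength `s`, and the axiom relating the two. -/
structure BistrongEndofunctor (C : Type u₂) [Category.{v₂} C] [MonoidalCategory C] where
  F : C ⥤ C
  t (A B : C) : A ⊗ F.obj B ⟶ F.obj (A ⊗ B)
  s (A B : C) : F.obj A ⊗ B ⟶ F.obj (A ⊗ B)
  t_natural_left : ∀ {A A' : C} (f : A ⟶ A') (B : C),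
    f ▷ F.obj B ≫ t A' B = t A B ≫ F.map (f ▷ B)
  t_natural_right : ∀ (A : C) {B B' : C} (g : B ⟶ B'),
    A ◁ F.map g ≫ t A B' = t A B ≫ F.map (A ◁ g)
  s_natural_left : ∀ {A A' : C} (f : A ⟶ A') (B : C),
    F.map f ▷ B ≫ s A' B = s A B ≫ F.map (f ▷ B)
  s_natural_right : ∀ (A : C) {B B' : C} (g : B ⟶ B'),
    F.obj A ◁ g ≫ s A B' = s A B ≫ F.map (A ◁ g)
  t_unit : ∀ A : C, t (𝟙_ C) A ≫ F.map (λ_ A).hom = (λ_ (F.obj A)).hom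
  t_assoc : ∀ A B D : C,
    t (A ⊗ B) D ≫ F.map (α_ A B D).hom = (α_ A B (F.obj D)).hom ≫ A ◁ t B D ≫ t A (B ⊗ D)
  s_unit : ∀ A : C, s A (𝟙_ C) ≫ F.map (ρ_ A).hom = (ρ_ (F.obj A)).hom
  s_assoc : ∀ A B D : C,
    s A B ▷ D ≫ s (A ⊗ B) D ≫ F.map (α_ A B D).hom = (α_ (F.obj A) B D).hom ≫ s A (B ⊗ D)
  bistrong : ∀ A B D : C,
    t A B ▷ D ≫ s (A ⊗ B) D ≫ F.map (α_ A B D).hom =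
      (α_ A (F.obj B) D).hom ≫ A ◁ s B D ≫ t A (B ⊗ D)

namespace BistrongEndofunctor

variable {C : Type u₂} [Category.{v₂} C] [MonoidalCategory C]

/-- A morphism of bistrong endofunctors: a natural transformation commuting with both strengths. -/
@[ext]
structure Hom (S T : BistrongEndofunctor C) where
  nat : S.F ⟶ T.F
  comm_t : ∀ A B : C, S.t A B ≫ nat.app (A ⊗ B) = A ◁ nat.app B ≫ T.t A B
  comm_s : ∀ A B : C, S.s A B ≫ nat.app (A ⊗ B) = nat.app A ▷ B ≫ T.s A B

instance : Category (BistrongEndofunctor C) where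
  Hom := Hom
  id S := ⟨𝟙 S.F, by simp, by simp⟩
  comp f g := ⟨f.nat ≫ g.nat, fun A B => by
      simp only [NatTrans.comp_app, whiskerLeft_comp, Category.assoc, ← g.comm_t]
      rw [← Category.assoc, f.comm_t, Category.assoc], fun A B => by
      simp only [NatTrans.comp_app, comp_whiskerRight, Category.assoc, ← g.comm_s]
      rw [← Category.assoc, f.comm_s, Category.assoc]⟩
  id_comp f := Hom.ext (Category.id_comp f.nat)
  comp_id f := Hom.ext (Category.comp_id f.nat)
  assoc f g h := Hom.ext (Category.assoc f.nat g.nat h.nat)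

@[ext]
theorem hom_ext {S T : BistrongEndofunctor C} {f g : S ⟶ T}
    (h : ∀ A : C, f.nat.app A = g.nat.app A) : f = g :=
  Hom.ext (NatTrans.ext (funext h))

@[simp]
theorem id_app (S : BistrongEndofunctor C) (A : C) : (𝟙 S : S ⟶ S).nat.app A = 𝟙 _ := rfl

@[simp]
theorem comp_app {S T U : BistrongEndofunctor C} (f : S ⟶ T) (g : T ⟶ U) (A : C) :
    (f ≫ g).nat.app A = f.nat.app A ≫ g.nat.app A := rfl

/-- The identity functor, with identity strengths. -/
def one : BistrongEndofunctor C where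
  F := 𝟭 C
  t _ _ := 𝟙 _
  s _ _ := 𝟙 _
  t_natural_left := by simp
  t_natural_right := by simp
  s_natural_left := by simp
  s_natural_right := by simp
  t_unit := by simp
  t_assoc := by simp
  s_unit := by simp
  s_assoc := by simp
  bistrong := by simp

/-- The composite `S ∘ T`, sending `A` to `S (T A)`, with the composite strengths. -/
def mul (S T : BistrongEndofunctor C) : BistrongEndofunctor C where
  F := T.F ⋙ S.F
  t A B := S.t A (T.F.obj B) ≫ S.F.map (T.t A B)
  s A B := S.s (T.F.obj A) B ≫ S.F.map (T.s A B)
  t_natural_left f B := by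
    simp only [Functor.comp_obj, Functor.comp_map, Category.assoc, ← Functor.map_comp,
      ← T.t_natural_left]
    rw [Functor.map_comp, ← Category.assoc, S.t_natural_left, Category.assoc]
  t_natural_right A B B' g := by
    simp only [Functor.comp_obj, Functor.comp_map, Category.assoc, ← Functor.map_comp,
      ← T.t_natural_right]
    rw [Functor.map_comp, ← Category.assoc, S.t_natural_right, Category.assoc]
  s_natural_left f B := by
    simp only [Functor.comp_obj, Functor.comp_map, Category.assoc, ← Functor.map_comp,
      ← T.s_natural_left]
    rw [Functor.map_comp, ← Category.assoc, S.s_natural_left, Category.assoc]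
  s_natural_right A B B' g := by
    simp only [Functor.comp_obj, Functor.comp_map, Category.assoc, ← Functor.map_comp,
      ← T.s_natural_right]
    rw [Functor.map_comp, ← Category.assoc, S.s_natural_right, Category.assoc]
  t_unit A := by
    simp only [Functor.comp_obj, Functor.comp_map, Category.assoc, ← Functor.map_comp, T.t_unit,
      S.t_unit]
  t_assoc A B D := by
    simp only [Functor.comp_obj, Functor.comp_map, Category.assoc, ← Functor.map_comp, T.t_assoc,
      whiskerLeft_comp]
    simp only [Functor.map_comp]
    rw [← Category.assoc, S.t_assoc, ← Category.assoc (A ◁ S.F.map _), S.t_natural_right]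
    simp only [Category.assoc]
  s_unit A := by
    simp only [Functor.comp_obj, Functor.comp_map, Category.assoc, ← Functor.map_comp, T.s_unit,
      S.s_unit]
  s_assoc A B D := by
    simp only [Functor.comp_obj, Functor.comp_map, Category.assoc, comp_whiskerRight]
    rw [← Category.assoc (S.F.map _ ▷ D), S.s_natural_left]
    simp only [Category.assoc, ← Functor.map_comp, T.s_assoc]
    simp only [Functor.map_comp]
    rw [← Category.assoc, ← Category.assoc, Category.assoc (_ ▷ _), S.s_assoc]
    simp only [Category.assoc]
  bistrong A B D := by
    simp only [Functor.comp_obj, Functor.comp_map, Category.assoc, comp_whiskerRight,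
      whiskerLeft_comp]
    rw [← Category.assoc (S.F.map _ ▷ D), S.s_natural_left]
    simp only [Category.assoc, ← Functor.map_comp, T.bistrong]
    simp only [Functor.map_comp]
    rw [← Category.assoc, ← Category.assoc, Category.assoc (_ ▷ _), S.bistrong,
      ← Category.assoc (A ◁ S.F.map _), S.t_natural_right]
    simp only [Category.assoc]

/-- Horizontal composition with a functor on the left. -/
def whiskL (S : BistrongEndofunctor C) {T U : BistrongEndofunctor C} (f : T ⟶ U) :
    S.mul T ⟶ S.mul U where
  nat := Functor.whiskerRight f.nat S.F
  comm_t A B := by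
    simp only [mul, Functor.comp_obj, Functor.whiskerRight_app, Category.assoc]
    rw [← Functor.map_comp, f.comm_t, Functor.map_comp, ← Category.assoc, ← S.t_natural_right,
      Category.assoc]
  comm_s A B := by
    simp only [mul, Functor.comp_obj, Functor.whiskerRight_app, Category.assoc]
    rw [← Functor.map_comp, f.comm_s, Functor.map_comp, ← Category.assoc, ← S.s_natural_left,
      Category.assoc]

/-- Horizontal composition with a functor on the right. -/
def whiskR {S T : BistrongEndofunctor C} (f : S ⟶ T) (U : BistrongEndofunctor C) :
    S.mul U ⟶ T.mul U where
  nat := Functor.whiskerLeft U.F f.nat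
  comm_t A B := by
    simp only [mul, Functor.comp_obj, Functor.whiskerLeft_app, Category.assoc]
    rw [f.nat.naturality, ← Category.assoc, f.comm_t, Category.assoc]
  comm_s A B := by
    simp only [mul, Functor.comp_obj, Functor.whiskerLeft_app, Category.assoc]
    rw [f.nat.naturality, ← Category.assoc, f.comm_s, Category.assoc]

/-- A natural isomorphism that commutes with both strengths, as an isomorphism. -/
def mkIso {S T : BistrongEndofunctor C} (h : S.F ≅ T.F)
    (ht : ∀ A B : C, S.t A B ≫ h.hom.app (A ⊗ B) = A ◁ h.hom.app B ≫ T.t A B)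
    (hs : ∀ A B : C, S.s A B ≫ h.hom.app (A ⊗ B) = h.hom.app A ▷ B ≫ T.s A B) : S ≅ T where
  hom := ⟨h.hom, ht, hs⟩
  inv := ⟨h.inv, fun A B => by
      rw [← cancel_mono (h.hom.app (A ⊗ B)), Category.assoc, Category.assoc, ht, ← Category.assoc
        (A ◁ _), ← whiskerLeft_comp]
      simp, fun A B => by
      rw [← cancel_mono (h.hom.app (A ⊗ B)), Category.assoc, Category.assoc, hs, ← Category.assoc
        (_ ▷ B), ← comp_whiskerRight]
      simp⟩
  hom_inv_id := by ext A; exact h.hom_inv_id_app A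
  inv_hom_id := by ext A; exact h.inv_hom_id_app A

/-- The monoidal category of bistrong endofunctors: the tensor product is composition,
`S ⊗ T = S ∘ T`, and the unit is the identity functor. -/
instance : MonoidalCategory (BistrongEndofunctor C) where
  tensorObj := mul
  tensorUnit := one
  whiskerLeft S _ _ f := whiskL S f
  whiskerRight f U := whiskR f U
  tensorHom {S _ _ U} f g := whiskR f _ ≫ whiskL _ g
  associator S T U := mkIso (Functor.associator U.F T.F S.F).symm (by simp [mul]) (by simp [mul])
  leftUnitor S := mkIso (Functor.rightUnitor S.F) (by simp [mul, one]) (by simp [mul, one])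
  rightUnitor S := mkIso (Functor.leftUnitor S.F) (by simp [mul, one]) (by simp [mul, one])
  tensorHom_def _ _ := rfl
  id_tensorHom_id S T := by ext A; simp [whiskL, whiskR, mul]
  tensorHom_comp_tensorHom f g h k := by ext A; simp [whiskL, whiskR, mul]
  whiskerLeft_id S T := by ext A; simp [whiskL, mul]
  id_whiskerRight S T := by ext A; simp [whiskR, mul]
  associator_naturality f g h := by ext A; simp [whiskL, whiskR, mul, mkIso]
  leftUnitor_naturality f := by ext A; simp [whiskL, one, mul, mkIso]
  rightUnitor_naturality f := by ext A; simp [whiskR, one, mul, mkIso]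
  pentagon S T U V := by ext A; simp [whiskL, whiskR, mul, mkIso]
  triangle S T := by ext A; simp [whiskL, whiskR, mul, mkIso, one]

end BistrongEndofunctor

/-- A bistrong graded monad on `C` with grades `E`: a lax monoidal functor from `E` to the monoidal
category of bistrong endofunctors of `C`. -/
structure BistrongGradedMonad (E : Type u₁) [Category.{v₁} E] [MonoidalCategory E]
    (C : Type u₂) [Category.{v₂} C] [MonoidalCategory C] where
  functor : E ⥤ BistrongEndofunctor C
  lax : functor.LaxMonoidal

namespace BistrongGradedMonad

variable {E : Type u₁} [Category.{v₁} E] [MonoidalCategory E]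
  {C : Type u₂} [Category.{v₂} C] [MonoidalCategory C] (T : BistrongGradedMonad E C)

/-- The functor `T_e`. -/
abbrev fn (e : E) : C ⥤ C := (T.functor.obj e).F

/-- The natural transformation `T_γ`, at `A`. -/
abbrev tr {e e' : E} (γ : e ⟶ e') (A : C) : (T.fn e).obj A ⟶ (T.fn e').obj A :=
  (T.functor.map γ).nat.app A

/-- The unit `ψ`, at `A`. -/
abbrev unit (A : C) : A ⟶ (T.fn (𝟙_ E)).obj A :=
  T.lax.ε.nat.app A

/-- The multiplication `φ : T_e ∘ T_e' ⟶ T_{e ⊗ e'}`, at `A`. -/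
abbrev mult (e e' : E) (A : C) : (T.fn e).obj ((T.fn e').obj A) ⟶ (T.fn (e ⊗ e')).obj A :=
  (T.lax.μ e e').nat.app A

/-- The left strength `t^e`. -/
abbrev t (e : E) (A B : C) : A ⊗ (T.fn e).obj B ⟶ (T.fn e).obj (A ⊗ B) :=
  (T.functor.obj e).t A B

/-- The right strength `s^e`. -/
abbrev s (e : E) (A B : C) : (T.fn e).obj A ⊗ B ⟶ (T.fn e).obj (A ⊗ B) :=
  (T.functor.obj e).s A B

/-! Componentwise form of the axioms. -/

theorem tr_id (e : E) (A : C) : T.tr (𝟙 e) A = 𝟙 _ := by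
  simp [tr]

theorem tr_comp {e e' e'' : E} (γ : e ⟶ e') (δ : e' ⟶ e'') (A : C) :
    T.tr (γ ≫ δ) A = T.tr γ A ≫ T.tr δ A := by
  simp [tr]

theorem tr_nat {e e' : E} (γ : e ⟶ e') {A B : C} (f : A ⟶ B) :
    (T.fn e).map f ≫ T.tr γ B = T.tr γ A ≫ (T.fn e').map f :=
  (T.functor.map γ).nat.naturality f

theorem unit_nat {A B : C} (f : A ⟶ B) :
    f ≫ T.unit B = T.unit A ≫ (T.fn (𝟙_ E)).map f :=
  T.lax.ε.nat.naturality f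

theorem mult_nat (e e' : E) {A B : C} (f : A ⟶ B) :
    (T.fn e).map ((T.fn e').map f) ≫ T.mult e e' B = T.mult e e' A ≫ (T.fn (e ⊗ e')).map f :=
  (T.lax.μ e e').nat.naturality f

theorem mult_tr_left {e e' : E} (γ : e ⟶ e') (d : E) (A : C) :
    T.tr γ ((T.fn d).obj A) ≫ T.mult e' d A = T.mult e d A ≫ T.tr (γ ▷ d) A :=
  congrArg (fun f => f.nat.app A) (T.lax.μ_natural_left γ d)

theorem mult_tr_right (d : E) {e e' : E} (γ : e ⟶ e') (A : C) :
    (T.fn d).map (T.tr γ A) ≫ T.mult d e' A = T.mult d e A ≫ T.tr (d ◁ γ) A :=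
  congrArg (fun f => f.nat.app A) (T.lax.μ_natural_right d γ)

theorem mult_assoc (e e' e'' : E) (A : C) :
    T.mult e e' ((T.fn e'').obj A) ≫ T.mult (e ⊗ e') e'' A ≫ T.tr (α_ e e' e'').hom A =
      (T.fn e).map (T.mult e' e'' A) ≫ T.mult e (e' ⊗ e'') A := by
  have h := congrArg (fun f => f.nat.app A) (T.lax.associativity e e' e'')
  exact h.trans (Category.id_comp _)

theorem mult_unit_left (e : E) (A : C) :
    T.unit ((T.fn e).obj A) ≫ T.mult (𝟙_ E) e A ≫ T.tr (λ_ e).hom A = 𝟙 _ :=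
  (congrArg (fun f => f.nat.app A) (T.lax.left_unitality e)).symm

theorem mult_unit_right (e : E) (A : C) :
    (T.fn e).map (T.unit A) ≫ T.mult e (𝟙_ E) A ≫ T.tr (ρ_ e).hom A = 𝟙 _ :=
  (congrArg (fun f => f.nat.app A) (T.lax.right_unitality e)).symm

theorem t_tr {e e' : E} (γ : e ⟶ e') (A B : C) :
    T.t e A B ≫ T.tr γ (A ⊗ B) = A ◁ T.tr γ B ≫ T.t e' A B :=
  (T.functor.map γ).comm_t A B

theorem s_tr {e e' : E} (γ : e ⟶ e') (A B : C) :
    T.s e A B ≫ T.tr γ (A ⊗ B) = T.tr γ A ▷ B ≫ T.s e' A B :=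
  (T.functor.map γ).comm_s A B

theorem t_unit (A B : C) : A ◁ T.unit B ≫ T.t (𝟙_ E) A B = T.unit (A ⊗ B) :=
  (T.lax.ε.comm_t A B).symm.trans (Category.id_comp _)

theorem s_unit (A B : C) : T.unit A ▷ B ≫ T.s (𝟙_ E) A B = T.unit (A ⊗ B) :=
  (T.lax.ε.comm_s A B).symm.trans (Category.id_comp _)

theorem t_mult (e e' : E) (A B : C) :
    T.t e A ((T.fn e').obj B) ≫ (T.fn e).map (T.t e' A B) ≫ T.mult e e' (A ⊗ B) =
      A ◁ T.mult e e' B ≫ T.t (e ⊗ e') A B :=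
  (Category.assoc _ _ _).symm.trans ((T.lax.μ e e').comm_t A B)

theorem s_mult (e e' : E) (A B : C) :
    T.s e ((T.fn e').obj A) B ≫ (T.fn e).map (T.s e' A B) ≫ T.mult e e' (A ⊗ B) =
      T.mult e e' A ▷ B ≫ T.s (e ⊗ e') A B :=
  (Category.assoc _ _ _).symm.trans ((T.lax.μ e e').comm_s A B)

/-- The objects of the Kleisli bicategory `K_T`: those of `C`. -/
@[ext]
structure Kleisli (T : BistrongGradedMonad E C) where
  of : C

/-- A 1-cell from `A` to `B` of `K_T`: a grade `e` and a map `A ⟶ T_e B`. -/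
structure OneCell (T : BistrongGradedMonad E C) (A B : C) where
  grade : E
  map : A ⟶ (T.fn grade).obj B

/-- A 2-cell of `K_T`: a map `γ` of grades with `T_γ ∘ f = f'`. -/
@[ext]
structure TwoCell {T : BistrongGradedMonad E C} {A B : C} (f f' : T.OneCell A B) where
  gr : f.grade ⟶ f'.grade
  comm : f.map ≫ T.tr gr B = f'.map

instance (A B : C) : Category (T.OneCell A B) where
  Hom := TwoCell
  id f := ⟨𝟙 f.grade, by rw [tr_id, Category.comp_id]⟩
  comp γ δ := ⟨γ.gr ≫ δ.gr, by rw [tr_comp, ← Category.assoc, γ.comm, δ.comm]⟩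
  id_comp γ := TwoCell.ext (Category.id_comp γ.gr)
  comp_id γ := TwoCell.ext (Category.comp_id γ.gr)
  assoc γ δ ε := TwoCell.ext (Category.assoc γ.gr δ.gr ε.gr)

variable {T}

@[ext]
theorem twoCell_ext {A B : C} {f g : T.OneCell A B} {γ δ : f ⟶ g} (h : γ.gr = δ.gr) : γ = δ :=
  TwoCell.ext h

@[simp]
theorem id_gr {A B : C} (f : T.OneCell A B) : (𝟙 f : f ⟶ f).gr = 𝟙 f.grade := rfl

@[simp]
theorem comp_gr {A B : C} {f g h : T.OneCell A B} (γ : f ⟶ g) (δ : g ⟶ h) :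
    (γ ≫ δ).gr = γ.gr ≫ δ.gr := rfl

/-- An isomorphism of grades compatible with two 1-cells, as an invertible 2-cell. -/
@[simps]
def isoOfGrade {A B : C} {f g : T.OneCell A B} (γ : f.grade ≅ g.grade)
    (h : f.map ≫ T.tr γ.hom B = g.map) : f ≅ g where
  hom := ⟨γ.hom, h⟩
  inv := ⟨γ.inv, by rw [← h, Category.assoc, ← tr_comp, γ.hom_inv_id, tr_id, Category.comp_id]⟩
  hom_inv_id := TwoCell.ext γ.hom_inv_id
  inv_hom_id := TwoCell.ext γ.inv_hom_id

/-- The identity 1-cell `ψ_A : A ⟶ T_I A`. -/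
@[simps]
def idCell (T : BistrongGradedMonad E C) (A : C) : T.OneCell A A := ⟨𝟙_ E, T.unit A⟩

/-- The composite `φ ∘ T_e g ∘ f : A ⟶ T_{e ⊗ e'} D` of `f : A ⟶ T_e B` and `g : B ⟶ T_e' D`. -/
@[simps]
def compCell {A B D : C} (f : T.OneCell A B) (g : T.OneCell B D) : T.OneCell A D :=
  ⟨f.grade ⊗ g.grade, f.map ≫ (T.fn f.grade).map g.map ≫ T.mult f.grade g.grade D⟩

/-- The Kleisli bicategory `K_T`; its structural isomorphisms are those of `E`. -/
instance : Bicategory T.Kleisli where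
  Hom A B := T.OneCell A.of B.of
  id A := T.idCell A.of
  comp f g := compCell f g
  homCategory A B := inferInstanceAs (Category (T.OneCell A.of B.of))
  whiskerLeft {A B D} f g h γ := ⟨f.grade ◁ γ.gr, by
    change (f.map ≫ (T.fn f.grade).map g.map ≫ T.mult f.grade g.grade D.of) ≫
      T.tr (f.grade ◁ γ.gr) D.of =
      f.map ≫ (T.fn f.grade).map h.map ≫ T.mult f.grade h.grade D.of
    simp only [← γ.comm, Category.assoc, Functor.map_comp, mult_tr_right]⟩
  whiskerRight {A B D f g} γ h := ⟨γ.gr ▷ h.grade, by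
    change (f.map ≫ (T.fn f.grade).map h.map ≫ T.mult f.grade h.grade D.of) ≫
      T.tr (γ.gr ▷ h.grade) D.of =
      g.map ≫ (T.fn g.grade).map h.map ≫ T.mult g.grade h.grade D.of
    simp only [← γ.comm, Category.assoc]
    rw [← mult_tr_left, ← Category.assoc ((T.fn f.grade).map _), tr_nat, Category.assoc]⟩
  associator {A B D G} f g h := isoOfGrade (α_ f.grade g.grade h.grade) (by
    simp only [compCell, Category.assoc, Functor.map_comp]
    rw [← mult_assoc, ← Category.assoc ((T.fn f.grade).map ((T.fn g.grade).map _)), mult_nat]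
    simp only [Category.assoc])
  leftUnitor {A B} f := isoOfGrade (λ_ f.grade) (by
    simp only [compCell, idCell, Category.assoc]
    rw [← Category.assoc, ← unit_nat, Category.assoc, mult_unit_left, Category.comp_id])
  rightUnitor {A B} f := isoOfGrade (ρ_ f.grade) (by
    simp only [compCell, idCell, Category.assoc, mult_unit_right, Category.comp_id])
  whiskerLeft_id f g := TwoCell.ext (MonoidalCategory.whiskerLeft_id f.grade g.grade)
  whiskerLeft_comp f _ _ _ γ δ := TwoCell.ext (MonoidalCategory.whiskerLeft_comp f.grade γ.gr δ.gr)
  id_whiskerLeft γ := TwoCell.ext (MonoidalCategory.id_whiskerLeft γ.gr)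
  comp_whiskerLeft f g _ _ γ :=
    TwoCell.ext (MonoidalCategory.tensor_whiskerLeft f.grade g.grade γ.gr)
  id_whiskerRight f g := TwoCell.ext (MonoidalCategory.id_whiskerRight f.grade g.grade)
  comp_whiskerRight γ δ i := TwoCell.ext (MonoidalCategory.comp_whiskerRight γ.gr δ.gr i.grade)
  whiskerRight_id γ := TwoCell.ext (MonoidalCategory.whiskerRight_id γ.gr)
  whiskerRight_comp γ g h :=
    TwoCell.ext (MonoidalCategory.whiskerRight_tensor γ.gr g.grade h.grade)
  whisker_assoc f _ _ γ h := TwoCell.ext (MonoidalCategory.whisker_assoc f.grade γ.gr h.grade)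
  whisker_exchange γ δ := TwoCell.ext (MonoidalCategory.whisker_exchange γ.gr δ.gr)
  pentagon f g h i := TwoCell.ext (MonoidalCategory.pentagon f.grade g.grade h.grade i.grade)
  triangle f g := TwoCell.ext (MonoidalCategory.triangle f.grade g.grade)

end BistrongGradedMonad

namespace BistrongGradedMonad

variable {E : Type u₁} [Category.{v₁} E] [MonoidalCategory E]
  {C : Type u₂} [Category.{v₂} C] [MonoidalCategory C] {T : BistrongGradedMonad E C}

/-- The grade of a 1-cell of `K_T`. -/
abbrev grade₁ {A B : T.Kleisli} (f : A ⟶ B) : E := OneCell.grade f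

/-- The map of grades underlying a 2-cell of `K_T`. -/
abbrev grade₂ {A B : T.Kleisli} {f g : A ⟶ B} (γ : f ⟶ g) : grade₁ f ⟶ grade₁ g := TwoCell.gr γ

/-- `A ⋊ (e, g) = (e, t ∘ (A ⊗ g))`. -/
@[simps]
def leftCell (A : C) {X X' : C} (g : T.OneCell X X') : T.OneCell (A ⊗ X) (A ⊗ X') :=
  ⟨g.grade, A ◁ g.map ≫ T.t g.grade A X'⟩

/-- `(e, f) ⋉ X = (e, s ∘ (f ⊗ X))`. -/
@[simps]
def rightCell {A A' : C} (f : T.OneCell A A') (X : C) : T.OneCell (A ⊗ X) (A' ⊗ X) :=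
  ⟨f.grade, f.map ▷ X ≫ T.s f.grade A' X⟩

theorem leftCell_id (A X : C) : (leftCell A (T.idCell X)).map = T.unit (A ⊗ X) :=
  T.t_unit A X

theorem rightCell_id (A X : C) : (rightCell (T.idCell A) X).map = T.unit (A ⊗ X) :=
  T.s_unit A X

theorem leftCell_comp (A : C) {X Y Z : C} (f : T.OneCell X Y) (g : T.OneCell Y Z) :
    (leftCell A (compCell f g)).map = (compCell (leftCell A f) (leftCell A g)).map := by
  simp only [leftCell, compCell, Category.assoc, MonoidalCategory.whiskerLeft_comp,
    Functor.map_comp]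
  rw [← t_mult, ← Category.assoc (A ◁ (T.fn f.grade).map _),
    (T.functor.obj f.grade).t_natural_right]
  simp only [Category.assoc]

theorem rightCell_comp {X Y Z : C} (f : T.OneCell X Y) (g : T.OneCell Y Z) (A : C) :
    (rightCell (compCell f g) A).map = (compCell (rightCell f A) (rightCell g A)).map := by
  simp only [rightCell, compCell, Category.assoc, MonoidalCategory.comp_whiskerRight,
    Functor.map_comp]
  rw [← s_mult, ← Category.assoc ((T.fn f.grade).map _ ▷ A),
    (T.functor.obj f.grade).s_natural_left]
  simp only [Category.assoc]

theorem associator_aux (e e' e'' : E) : (α_ e e' e'').hom =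
    𝟙 _ ≫ (𝟙 (e ⊗ e')) ▷ e'' ≫ (α_ e e' e'').hom ≫ e ◁ (𝟙 (e' ⊗ e'')) ≫ 𝟙 _ := by simp

theorem leftUnitor_aux (e : E) : (λ_ e).hom = 𝟙 _ ≫ (𝟙 (𝟙_ E)) ▷ e ≫ (λ_ e).hom := by simp

theorem rightUnitor_aux (e : E) : (ρ_ e).hom = 𝟙 _ ≫ e ◁ (𝟙 (𝟙_ E)) ≫ (ρ_ e).hom := by simp

/-- The binoidal structure of `K_T`. All the unitors and compositors have the identity as underlying
map of grades. -/
instance : BinoidalBicategory T.Kleisli where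
  tensorObj A X := ⟨A.of ⊗ X.of⟩
  leftOn A :=
    { map := fun g => leftCell A.of g
      map₂ := fun {X X' f g} γ => ⟨γ.gr, by
        change (A.of ◁ f.map ≫ T.t f.grade A.of X'.of) ≫ T.tr γ.gr (A.of ⊗ X'.of) =
          A.of ◁ g.map ≫ T.t g.grade A.of X'.of
        rw [Category.assoc, t_tr, ← Category.assoc, ← MonoidalCategory.whiskerLeft_comp, γ.comm]⟩
      mapId := fun X => isoOfGrade (Iso.refl (𝟙_ E)) (by
        refine (congrArg (· ≫ _) (leftCell_id A.of X.of)).trans ?_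
        exact (congrArg (_ ≫ ·) (tr_id T _ _)).trans (Category.comp_id _))
      mapComp := fun f g => isoOfGrade (Iso.refl (OneCell.grade f ⊗ OneCell.grade g)) (by
        refine (congrArg (· ≫ _) (leftCell_comp A.of f g)).trans ?_
        exact (congrArg (_ ≫ ·) (tr_id T _ _)).trans (Category.comp_id _))
      map₂_id := fun f => rfl
      map₂_comp := fun η θ => rfl
      map₂_whisker_left := fun f _ _ η => TwoCell.ext (by
        exact ((Category.id_comp _).trans (Category.comp_id _)).symm)
      map₂_whisker_right := fun η h => TwoCell.ext (by
        exact ((Category.id_comp _).trans (Category.comp_id _)).symm)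
      map₂_associator := fun f g h => TwoCell.ext
        (associator_aux (OneCell.grade f) (OneCell.grade g) (OneCell.grade h))
      map₂_left_unitor := fun f => TwoCell.ext (leftUnitor_aux (OneCell.grade f))
      map₂_right_unitor := fun f => TwoCell.ext (rightUnitor_aux (OneCell.grade f)) }
  rightOn X :=
    { map := fun f => rightCell f X.of
      map₂ := fun {A A' f g} γ => ⟨γ.gr, by
        change (f.map ▷ X.of ≫ T.s f.grade A'.of X.of) ≫ T.tr γ.gr (A'.of ⊗ X.of) =
          g.map ▷ X.of ≫ T.s g.grade A'.of X.of
        rw [Category.assoc, s_tr, ← Category.assoc, ← MonoidalCategory.comp_whiskerRight, γ.comm]⟩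
      mapId := fun A => isoOfGrade (Iso.refl (𝟙_ E)) (by
        refine (congrArg (· ≫ _) (rightCell_id A.of X.of)).trans ?_
        exact (congrArg (_ ≫ ·) (tr_id T _ _)).trans (Category.comp_id _))
      mapComp := fun f g => isoOfGrade (Iso.refl (OneCell.grade f ⊗ OneCell.grade g)) (by
        refine (congrArg (· ≫ _) (rightCell_comp f g X.of)).trans ?_
        exact (congrArg (_ ≫ ·) (tr_id T _ _)).trans (Category.comp_id _))
      map₂_id := fun f => rfl
      map₂_comp := fun η θ => rfl
      map₂_whisker_left := fun f _ _ η => TwoCell.ext (by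
        exact ((Category.id_comp _).trans (Category.comp_id _)).symm)
      map₂_whisker_right := fun η h => TwoCell.ext (by
        exact ((Category.id_comp _).trans (Category.comp_id _)).symm)
      map₂_associator := fun f g h => TwoCell.ext
        (associator_aux (OneCell.grade f) (OneCell.grade g) (OneCell.grade h))
      map₂_left_unitor := fun f => TwoCell.ext (leftUnitor_aux (OneCell.grade f))
      map₂_right_unitor := fun f => TwoCell.ext (rightUnitor_aux (OneCell.grade f)) }

/-- The 1-cell `ψ ∘ f`, of grade `I`, of `K_T` given by a map `f` of `C`. -/
def pureCell (T : BistrongGradedMonad E C) {A B : C} (f : A ⟶ B) :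
    (⟨A⟩ : T.Kleisli) ⟶ (⟨B⟩ : T.Kleisli) :=
  (⟨𝟙_ E, f ≫ T.unit B⟩ : T.OneCell A B)

/-- The unit and the structural 1-cells of `K_T`, lifted from the monoidal category `C`. -/
def cells (T : BistrongGradedMonad E C) : PremonoidalCells T.Kleisli where
  unit := ⟨𝟙_ C⟩
  assoc A X Y := T.pureCell (α_ A.of X.of Y.of).hom
  lam A := T.pureCell (λ_ A.of).hom
  rho A := T.pureCell (ρ_ A.of).hom

/-- The canonical isomorphism `e ⊗ I ⟶ I ⊗ e`. -/
def swapUnit (e : E) : e ⊗ 𝟙_ E ⟶ 𝟙_ E ⊗ e := (ρ_ e).hom ≫ (λ_ e).inv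

/-- A premonoidal structure on `K_T` on the 1-cells lifted from `C` is canonical if all its
structural 2-cells are given by the canonical isomorphisms of `E`, and the equivalences are given by
the lifts of the inverses of the structural isomorphisms of `C`. -/
structure IsCanonical (P : PremonoidalStructure T.cells) : Prop where
  lam : ∀ {A A' : T.Kleisli} (f : A ⟶ A'), grade₂ (P.lamC f).hom = swapUnit (grade₁ f)
  rho : ∀ {A A' : T.Kleisli} (f : A ⟶ A'), grade₂ (P.rhoC f).hom = swapUnit (grade₁ f)
  assoc₁ : ∀ {A A' : T.Kleisli} (f : A ⟶ A') (X Y : T.Kleisli),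
    grade₂ (P.assoc₁ f X Y).hom = swapUnit (grade₁ f)
  assoc₂ : ∀ (A : T.Kleisli) {X X' : T.Kleisli} (f : X ⟶ X') (Y : T.Kleisli),
    grade₂ (P.assoc₂ A f Y).hom = swapUnit (grade₁ f)
  assoc₃ : ∀ (A X : T.Kleisli) {Y Y' : T.Kleisli} (f : Y ⟶ Y'),
    grade₂ (P.assoc₃ A X f).hom = swapUnit (grade₁ f)
  lam_lc : ∀ (A : T.Kleisli) {X X' : T.Kleisli} (f : X ⟶ X'),
    grade₂ ((P.lamCentral A).lcAt f).hom = swapUnit (grade₁ f)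
  lam_rc : ∀ (A : T.Kleisli) {X X' : T.Kleisli} (f : X ⟶ X'),
    grade₂ ((P.lamCentral A).rcAt f).hom = swapUnit (grade₁ f)
  rho_lc : ∀ (A : T.Kleisli) {X X' : T.Kleisli} (f : X ⟶ X'),
    grade₂ ((P.rhoCentral A).lcAt f).hom = swapUnit (grade₁ f)
  rho_rc : ∀ (A : T.Kleisli) {X X' : T.Kleisli} (f : X ⟶ X'),
    grade₂ ((P.rhoCentral A).rcAt f).hom = swapUnit (grade₁ f)
  assoc_lc : ∀ (A X Y : T.Kleisli) {Z Z' : T.Kleisli} (f : Z ⟶ Z'),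
    grade₂ ((P.assocCentral A X Y).lcAt f).hom = swapUnit (grade₁ f)
  assoc_rc : ∀ (A X Y : T.Kleisli) {Z Z' : T.Kleisli} (f : Z ⟶ Z'),
    grade₂ ((P.assocCentral A X Y).rcAt f).hom = swapUnit (grade₁ f)
  lam_inv : ∀ A : T.Kleisli, (P.lamEquiv A).inv = T.pureCell (λ_ A.of).inv
  rho_inv : ∀ A : T.Kleisli, (P.rhoEquiv A).inv = T.pureCell (ρ_ A.of).inv
  assoc_inv : ∀ A X Y : T.Kleisli,
    (P.assocEquiv A X Y).inv = T.pureCell (α_ A.of X.of Y.of).inv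
  p : ∀ A X Y Z : T.Kleisli, grade₂ (P.p A X Y Z).hom = 𝟙_ E ◁ (λ_ (𝟙_ E)).hom
  m : ∀ A X : T.Kleisli, grade₂ (P.m A X).hom = (λ_ (𝟙_ E)).hom
  l : ∀ A X : T.Kleisli, grade₂ (P.l A X).hom = (λ_ (𝟙_ E)).inv
  r : ∀ A X : T.Kleisli, grade₂ (P.r A X).hom = (λ_ (𝟙_ E)).inv

end BistrongGradedMonad

end Graded

/-!
The 2-cells of `K_T` are maps of grades subject to a condition, so two parallel 2-cells are equal as
soon as their maps of grades are (`twoCell_ext`). This divides the proof into two independent parts.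

* Existence of the 2-cells takes place in `C`. A 1-cell lifted from `C` has grade `I`; composing it
  with a 1-cell of grade `e` on either side amounts, up to the unitors of `E`, to composing with a
  map of `C` or with its image under `T_e` (`pure_comp`, `comp_pure`). A square of `K_T` with sides
  lifted from `C` is therefore filled by the canonical isomorphism `e ⊗ I ≅ I ⊗ e` as soon as an
  ordinary square commutes in `C` (`squareIso`). The squares that occur are exactly the axioms of a
  bistrong endofunctor: compatibility of the strengths with the unitors and associators gives
  pseudonaturality (the axiom relating `t` and `s` being the case of the middle argument), and the
  naturality of the strengths in the object they absorb gives centrality. The 2-cells `p`, `m`, `l`,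
  `r` come from the pentagon and triangle identities of `C` (`pentagonIso`, `triangleIso`).

* All equations between 2-cells take place in `E`. Since the action of `A ⋊ (-)` and `(-) ⋉ X` on
  2-cells does not change the map of grades, every axiom becomes either the naturality of
  `e ⊗ I ≅ I ⊗ e` in `e` or an equation between composites of structural isomorphisms of `E`, which
  holds by the coherence theorem.

If `E` is strict, the maps of grades of the structural 2-cells are identities, and then so are the
2-cells themselves (`isIdentity_of_gr`).
-/

namespace BistrongGradedMonad

open MonoidalCategory

variable {E : Type u₁} [Category.{v₁} E] [MonoidalCategory E]
  {C : Type u₂} [Category.{v₂} C] [MonoidalCategory C] {T : BistrongGradedMonad E C}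

/-! ### Grades of composites -/

section Grades

open Bicategory

@[simp]
theorem grade_comp {A B D : T.Kleisli} (f : A ⟶ B) (g : B ⟶ D) :
    OneCell.grade (f ≫ g) = OneCell.grade f ⊗ OneCell.grade g := rfl

@[simp]
theorem grade_ltMap (A : T.Kleisli) {B D : T.Kleisli} (f : B ⟶ D) :
    OneCell.grade (A ⋊ f) = OneCell.grade f := rfl

@[simp]
theorem grade_rtMap {B D : T.Kleisli} (f : B ⟶ D) (A : T.Kleisli) :
    OneCell.grade (f ⋉ A) = OneCell.grade f := rfl

@[simp]
theorem gr_id {A B : T.Kleisli} (f : A ⟶ B) : TwoCell.gr (𝟙 f) = 𝟙 (OneCell.grade f) := rfl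

@[simp]
theorem gr_comp {A B : T.Kleisli} {f g h : A ⟶ B} (γ : f ⟶ g) (δ : g ⟶ h) :
    TwoCell.gr (γ ≫ δ) = TwoCell.gr γ ≫ TwoCell.gr δ := rfl

@[simp]
theorem gr_whiskerLeft {A B D : T.Kleisli} (f : A ⟶ B) {g h : B ⟶ D} (γ : g ⟶ h) :
    TwoCell.gr (f ◁ γ) = OneCell.grade f ◁ TwoCell.gr γ := rfl

@[simp]
theorem gr_whiskerRight {A B D : T.Kleisli} {f g : A ⟶ B} (γ : f ⟶ g) (h : B ⟶ D) :
    TwoCell.gr (γ ▷ h) = TwoCell.gr γ ▷ OneCell.grade h := rfl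

@[simp]
theorem gr_associator_hom {A B D G : T.Kleisli} (f : A ⟶ B) (g : B ⟶ D) (h : D ⟶ G) :
    TwoCell.gr (Bicategory.associator f g h).hom =
      (MonoidalCategory.associator (OneCell.grade f) (OneCell.grade g) (OneCell.grade h)).hom := rfl

@[simp]
theorem gr_associator_inv {A B D G : T.Kleisli} (f : A ⟶ B) (g : B ⟶ D) (h : D ⟶ G) :
    TwoCell.gr (Bicategory.associator f g h).inv =
      (MonoidalCategory.associator (OneCell.grade f) (OneCell.grade g) (OneCell.grade h)).inv := rfl

end Grades

/-! ### Naturality of the canonical isomorphism `e ⊗ I ≅ I ⊗ e` -/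

/-- The canonical isomorphism `e ⊗ I ≅ I ⊗ e`. -/
def swapIso (e : E) : e ⊗ 𝟙_ E ≅ 𝟙_ E ⊗ e := ρ_ e ≪≫ (λ_ e).symm

/-- The naturality axiom of the pseudonaturality 2-cells. -/
theorem swapUnit_naturality {e e' : E} (γ : e ⟶ e') :
    γ ▷ 𝟙_ E ≫ swapUnit e' = swapUnit e ≫ 𝟙_ E ◁ γ := by
  simp [swapUnit]

/-- The unit axiom of the pseudonaturality 2-cells. The maps `k` and `l` stand for the grades of the
unitors of the two pseudofunctors, which are identities only propositionally for composite
pseudofunctors. -/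
theorem swapUnit_tensorUnit {k l : 𝟙_ E ⟶ 𝟙_ E} (hk : k = 𝟙 _) (hl : l = 𝟙 _) :
    swapUnit (𝟙_ E) ≫ 𝟙_ E ◁ k = l ▷ 𝟙_ E ≫ (λ_ (𝟙_ E)).hom ≫ (ρ_ (𝟙_ E)).inv := by
  subst hk hl
  simp only [swapUnit]
  monoidal

/-- The composition axiom of the pseudonaturality 2-cells, where `k` and `l` stand for the grades of
the compositors of the two pseudofunctors. -/
theorem swapUnit_tensorObj (e e' : E) {k l : e ⊗ e' ⟶ e ⊗ e'} (hk : k = 𝟙 _) (hl : l = 𝟙 _) :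
    swapUnit (e ⊗ e') ≫ 𝟙_ E ◁ k =
      l ▷ 𝟙_ E ≫ (α_ e e' (𝟙_ E)).hom ≫ e ◁ swapUnit e' ≫ (α_ e (𝟙_ E) e').inv ≫
        swapUnit e ▷ e' ≫ (α_ (𝟙_ E) e e').hom := by
  subst hk hl
  simp only [swapUnit]
  monoidal

/-! ### Composition with 1-cells lifted from `C` -/

/-- Composing with a lifted map after a 1-cell of grade `e` amounts to applying `T_e` to it. -/
theorem comp_pure {X Y Z : C} (f : T.OneCell X Y) (h : Y ⟶ Z) :
    (compCell f (⟨𝟙_ E, h ≫ T.unit Z⟩ : T.OneCell Y Z)).map ≫ T.tr (ρ_ f.grade).hom Z =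
      f.map ≫ (T.fn f.grade).map h := by
  simp only [compCell, Functor.map_comp, Category.assoc, mult_unit_right, Category.comp_id]

/-- Composing with a lifted map before a 1-cell amounts to precomposing with it in `C`. -/
theorem pure_comp {X Y Z : C} (h : X ⟶ Y) (f : T.OneCell Y Z) :
    (compCell (⟨𝟙_ E, h ≫ T.unit Y⟩ : T.OneCell X Y) f).map ≫ T.tr (λ_ f.grade).hom Z =
      h ≫ f.map := by
  simp only [compCell, Category.assoc]
  rw [← reassoc_of% (unit_nat T f.map), mult_unit_left, Category.comp_id]

/-- `pure_comp` with the unitor on the other side, for a map `x` that is only propositionally of the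
form `ψ ∘ h`, as are the maps of `A ⋊ f` and `f ⋉ A` for a lifted map `f`. -/
theorem pure_comp_map {X Y Z : C} {x : X ⟶ (T.fn (𝟙_ E)).obj Y} {h : X ⟶ Y}
    (hx : x = h ≫ T.unit Y) (f : T.OneCell Y Z) :
    (compCell (⟨𝟙_ E, x⟩ : T.OneCell X Y) f).map = h ≫ f.map ≫ T.tr (λ_ f.grade).inv Z := by
  subst hx
  refine Eq.trans ?_ (Category.assoc _ _ _)
  refine Eq.trans ?_ (congrArg (· ≫ _) (pure_comp h f))
  refine Eq.trans ?_ (Category.assoc _ _ _).symm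
  have w : T.tr (λ_ f.grade).hom Z ≫ T.tr (λ_ f.grade).inv Z = 𝟙 _ := by
    rw [← tr_comp, Iso.hom_inv_id, tr_id]
  exact ((congrArg (_ ≫ ·) w).trans (Category.comp_id _)).symm

/-- A commuting square in `C` between two 1-cells of grade `e`, along two maps of `C`, gives an
invertible 2-cell with the canonical isomorphism `e ⊗ I ≅ I ⊗ e` as map of grades. -/
def squareIso {X X' Y Y' : C} {e : E} {f : X ⟶ (T.fn e).obj Y} {g : X' ⟶ (T.fn e).obj Y'}
    {x : X ⟶ (T.fn (𝟙_ E)).obj X'} {y : Y ⟶ (T.fn (𝟙_ E)).obj Y'} (h : X ⟶ X') (k : Y ⟶ Y')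
    (hx : x = h ≫ T.unit X') (hy : y = k ≫ T.unit Y') (w : f ≫ (T.fn e).map k = h ≫ g) :
    compCell (⟨e, f⟩ : T.OneCell X Y) ⟨𝟙_ E, y⟩ ≅ compCell (⟨𝟙_ E, x⟩ : T.OneCell X X') ⟨e, g⟩ :=
  isoOfGrade (swapIso e) (by
    subst hy
    refine (congrArg (_ ≫ ·) (tr_comp T (ρ_ e).hom (λ_ e).inv Y')).trans ?_
    refine (Category.assoc _ _ _).symm.trans ?_
    refine (congrArg (· ≫ _) ((comp_pure (T := T) ⟨e, f⟩ k).trans w)).trans ?_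
    exact (Category.assoc _ _ _).trans (pure_comp_map hx ⟨e, g⟩).symm)

/-- A commuting triangle of maps of `C` lifts to an invertible 2-cell, with map of grades
`I ⊗ I ≅ I`. -/
def triangleIso {X Y Z : C} {x : X ⟶ (T.fn (𝟙_ E)).obj Y} {y : Y ⟶ (T.fn (𝟙_ E)).obj Z}
    {z : X ⟶ (T.fn (𝟙_ E)).obj Z} {h : X ⟶ Y} {k : Y ⟶ Z} {l : X ⟶ Z}
    (hx : x = h ≫ T.unit Y) (hy : y = k ≫ T.unit Z) (hz : z = l ≫ T.unit Z) (w : h ≫ k = l) :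
    compCell (⟨𝟙_ E, x⟩ : T.OneCell X Y) ⟨𝟙_ E, y⟩ ≅ (⟨𝟙_ E, z⟩ : T.OneCell X Z) :=
  isoOfGrade (λ_ (𝟙_ E)) (by
    subst hx hy hz w
    exact (pure_comp (T := T) h ⟨𝟙_ E, k ≫ T.unit Z⟩).trans (Category.assoc _ _ _).symm)

/-- A commuting pentagon of maps of `C` lifts to an invertible 2-cell, with map of grades
`I ⊗ (I ⊗ I) ≅ I ⊗ I`. -/
def pentagonIso {X Y Y' Z V : C} {x : X ⟶ (T.fn (𝟙_ E)).obj Y} {y : Y ⟶ (T.fn (𝟙_ E)).obj Z}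
    {z : Z ⟶ (T.fn (𝟙_ E)).obj V} {x' : X ⟶ (T.fn (𝟙_ E)).obj Y'}
    {y' : Y' ⟶ (T.fn (𝟙_ E)).obj V} {h : X ⟶ Y} {k : Y ⟶ Z} {l : Z ⟶ V} {h' : X ⟶ Y'}
    {k' : Y' ⟶ V} (hx : x = h ≫ T.unit Y) (hy : y = k ≫ T.unit Z) (hz : z = l ≫ T.unit V)
    (hx' : x' = h' ≫ T.unit Y') (hy' : y' = k' ≫ T.unit V) (w : h ≫ k ≫ l = h' ≫ k') :
    compCell (⟨𝟙_ E, x⟩ : T.OneCell X Y) (compCell (⟨𝟙_ E, y⟩ : T.OneCell Y Z) ⟨𝟙_ E, z⟩) ≅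
      compCell (⟨𝟙_ E, x'⟩ : T.OneCell X Y') ⟨𝟙_ E, y'⟩ :=
  isoOfGrade (whiskerLeftIso (𝟙_ E) (λ_ (𝟙_ E))) (by
    -- On the left, `pure_comp_map` produces two inverse unitors, on the right only one; the
    -- additional one cancels the map of grades of the 2-cell.
    have h₀ : (λ_ (𝟙_ E ⊗ 𝟙_ E)).inv ≫ 𝟙_ E ◁ (λ_ (𝟙_ E)).hom = 𝟙 (𝟙_ E ⊗ 𝟙_ E) := by monoidal
    rw [pure_comp_map hx, pure_comp_map hx', pure_comp_map hy]
    subst hz hy'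
    have h₁ : T.tr (λ_ (𝟙_ E ⊗ 𝟙_ E)).inv V ≫ T.tr (𝟙_ E ◁ (λ_ (𝟙_ E)).hom) V = 𝟙 _ := by
      rw [← tr_comp, h₀, tr_id]
    change (h ≫ (k ≫ (l ≫ T.unit V) ≫ T.tr (λ_ (𝟙_ E)).inv V) ≫
      T.tr (λ_ (𝟙_ E ⊗ 𝟙_ E)).inv V) ≫ T.tr (𝟙_ E ◁ (λ_ (𝟙_ E)).hom) V =
        h' ≫ (k' ≫ T.unit V) ≫ T.tr (λ_ (𝟙_ E)).inv V
    simp only [Category.assoc, h₁, Category.comp_id]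
    rw [reassoc_of% w])

theorem leftUnitor_tensor (A X : C) :
    (α_ (𝟙_ C) A X).hom ≫ (λ_ (A ⊗ X)).hom = (λ_ A).hom ▷ X := by simp

theorem rightUnitor_tensor (A X : C) :
    (α_ A X (𝟙_ C)).hom ≫ A ◁ (ρ_ X).hom = (ρ_ (A ⊗ X)).hom := by simp

theorem leftCell_pure (A : C) {X Y : C} (h : X ⟶ Y) :
    A ◁ (h ≫ T.unit Y) ≫ T.t (𝟙_ E) A Y = A ◁ h ≫ T.unit (A ⊗ Y) := by
  rw [MonoidalCategory.whiskerLeft_comp, Category.assoc, t_unit]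

theorem rightCell_pure {X Y : C} (h : X ⟶ Y) (A : C) :
    (h ≫ T.unit Y) ▷ A ≫ T.s (𝟙_ E) Y A = h ▷ A ≫ T.unit (Y ⊗ A) := by
  rw [MonoidalCategory.comp_whiskerRight, Category.assoc, s_unit]

end BistrongGradedMonad

/-! ### Squares of structural maps in `C` -/

namespace BistrongEndofunctor

open MonoidalCategory

variable {C : Type u₂} [Category.{v₂} C] [MonoidalCategory C] (S : BistrongEndofunctor C)

/-! Each of these lemmas says, when `S` is `T_e`, that a structural map of `C` (or, for centrality,
any map `h`) is natural with respect to the 1-cells of grade `e`, on which `A ⋊ (-)` and `(-) ⋉ X` act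
through the strengths. -/

theorem lam_square {A A' : C} (f : A ⟶ S.F.obj A') :
    (𝟙_ C ◁ f ≫ S.t (𝟙_ C) A') ≫ S.F.map (λ_ A').hom = (λ_ A).hom ≫ f := by
  rw [Category.assoc, S.t_unit, leftUnitor_naturality]

theorem rho_square {A A' : C} (f : A ⟶ S.F.obj A') :
    (f ▷ 𝟙_ C ≫ S.s A' (𝟙_ C)) ≫ S.F.map (ρ_ A').hom = (ρ_ A).hom ≫ f := by
  rw [Category.assoc, S.s_unit, rightUnitor_naturality]

theorem assoc_square₁ {A A' : C} (f : A ⟶ S.F.obj A') (X Y : C) :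
    ((f ▷ X ≫ S.s A' X) ▷ Y ≫ S.s (A' ⊗ X) Y) ≫ S.F.map (α_ A' X Y).hom =
      (α_ A X Y).hom ≫ f ▷ (X ⊗ Y) ≫ S.s A' (X ⊗ Y) := by
  rw [MonoidalCategory.comp_whiskerRight, Category.assoc, Category.assoc, S.s_assoc,
    associator_naturality_left_assoc]

theorem assoc_square₂ (A : C) {X X' : C} (f : X ⟶ S.F.obj X') (Y : C) :
    ((A ◁ f ≫ S.t A X') ▷ Y ≫ S.s (A ⊗ X') Y) ≫ S.F.map (α_ A X' Y).hom =
      (α_ A X Y).hom ≫ A ◁ (f ▷ Y ≫ S.s X' Y) ≫ S.t A (X' ⊗ Y) := by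
  rw [MonoidalCategory.comp_whiskerRight, MonoidalCategory.whiskerLeft_comp, Category.assoc,
    Category.assoc, Category.assoc, S.bistrong, associator_naturality_middle_assoc]

theorem assoc_square₃ (A X : C) {Y Y' : C} (f : Y ⟶ S.F.obj Y') :
    ((A ⊗ X) ◁ f ≫ S.t (A ⊗ X) Y') ≫ S.F.map (α_ A X Y').hom =
      (α_ A X Y).hom ≫ A ◁ (X ◁ f ≫ S.t X Y') ≫ S.t A (X ⊗ Y') := by
  rw [MonoidalCategory.whiskerLeft_comp, Category.assoc, Category.assoc, S.t_assoc,
    associator_naturality_right_assoc]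

theorem left_central_square {A A' : C} (h : A ⟶ A') {X X' : C} (g : X ⟶ S.F.obj X') :
    (A ◁ g ≫ S.t A X') ≫ S.F.map (h ▷ X') = h ▷ X ≫ A' ◁ g ≫ S.t A' X' := by
  rw [Category.assoc, ← S.t_natural_left, whisker_exchange_assoc]

theorem right_central_square {A A' : C} (h : A ⟶ A') {X X' : C} (g : X ⟶ S.F.obj X') :
    (g ▷ A ≫ S.s X' A) ≫ S.F.map (X' ◁ h) = X ◁ h ≫ g ▷ A' ≫ S.s X' A' := by
  rw [Category.assoc, ← S.s_natural_right, whisker_exchange_assoc]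

end BistrongEndofunctor

namespace BistrongGradedMonad

open MonoidalCategory

variable {E : Type u₁} [Category.{v₁} E] [MonoidalCategory E]
  {C : Type u₂} [Category.{v₂} C] [MonoidalCategory C] {T : BistrongGradedMonad E C}

/-! ### Pseudonaturality and centrality of the lifted structural isomorphisms -/

/-- The left unitor, pseudonatural because the left strength is compatible with the unit. -/
def lamNat (T : BistrongGradedMonad E C) :
    Pseudonat (leftAct T.cells.unit) (Pseudofunctor.id T.Kleisli) T.cells.lam where
  cell {A A'} f := squareIso (λ_ A.of).hom (λ_ A'.of).hom rfl rfl
    ((T.functor.obj (OneCell.grade f)).lam_square (OneCell.map f))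
  naturality _ := TwoCell.ext (swapUnit_naturality _)
  cell_id _ := TwoCell.ext (swapUnit_tensorUnit rfl rfl)
  cell_comp _ _ := TwoCell.ext (swapUnit_tensorObj _ _ rfl rfl)

/-- The right unitor, pseudonatural because the right strength is compatible with the unit. -/
def rhoNat (T : BistrongGradedMonad E C) :
    Pseudonat (rightAct T.cells.unit) (Pseudofunctor.id T.Kleisli) T.cells.rho where
  cell {A A'} f := squareIso (ρ_ A.of).hom (ρ_ A'.of).hom rfl rfl
    ((T.functor.obj (OneCell.grade f)).rho_square (OneCell.map f))
  naturality _ := TwoCell.ext (swapUnit_naturality _)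
  cell_id _ := TwoCell.ext (swapUnit_tensorUnit rfl rfl)
  cell_comp _ _ := TwoCell.ext (swapUnit_tensorObj _ _ rfl rfl)

/-- Pseudonaturality of the associator in its first argument: compatibility of the right strength
with the associator. -/
def assocNat₁ (T : BistrongGradedMonad E C) (X Y : T.Kleisli) :
    Pseudonat ((rightAct X).comp (rightAct Y)) (rightAct (X ⊙ Y))
      (fun A => T.cells.assoc A X Y) where
  cell {A A'} f := squareIso (α_ A.of X.of Y.of).hom (α_ A'.of X.of Y.of).hom rfl rfl
    ((T.functor.obj (OneCell.grade f)).assoc_square₁ (OneCell.map f) X.of Y.of)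
  naturality _ := TwoCell.ext (swapUnit_naturality _)
  cell_id _ := TwoCell.ext (swapUnit_tensorUnit rfl (Category.comp_id _))
  cell_comp _ _ := TwoCell.ext (swapUnit_tensorObj _ _ rfl (Category.comp_id _))

/-- Pseudonaturality of the associator in its second argument: the compatibility of the two
strengths. -/
def assocNat₂ (T : BistrongGradedMonad E C) (A Y : T.Kleisli) :
    Pseudonat ((leftAct A).comp (rightAct Y)) ((rightAct Y).comp (leftAct A))
      (fun X => T.cells.assoc A X Y) where
  cell {X X'} f := squareIso (α_ A.of X.of Y.of).hom (α_ A.of X'.of Y.of).hom rfl rfl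
    ((T.functor.obj (OneCell.grade f)).assoc_square₂ A.of (OneCell.map f) Y.of)
  naturality _ := TwoCell.ext (swapUnit_naturality _)
  cell_id _ := TwoCell.ext (swapUnit_tensorUnit (Category.comp_id _) (Category.comp_id _))
  cell_comp _ _ := TwoCell.ext
    (swapUnit_tensorObj _ _ (Category.comp_id _) (Category.comp_id _))

/-- Pseudonaturality of the associator in its third argument: compatibility of the left strength
with the associator. -/
def assocNat₃ (T : BistrongGradedMonad E C) (A X : T.Kleisli) :
    Pseudonat (leftAct (A ⊙ X)) ((leftAct X).comp (leftAct A))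
      (fun Y => T.cells.assoc A X Y) where
  cell {Y Y'} f := squareIso (α_ A.of X.of Y.of).hom (α_ A.of X.of Y'.of).hom rfl rfl
    ((T.functor.obj (OneCell.grade f)).assoc_square₃ A.of X.of (OneCell.map f))
  naturality _ := TwoCell.ext (swapUnit_naturality _)
  cell_id _ := TwoCell.ext (swapUnit_tensorUnit (Category.comp_id _) rfl)
  cell_comp _ _ := TwoCell.ext (swapUnit_tensorObj _ _ (Category.comp_id _) rfl)

/-- The 1-cells lifted from `C` are central: the strengths are natural in the object they
absorb. -/
def pureCentral (T : BistrongGradedMonad E C) {A A' : C} (h : A ⟶ A') :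
    CentralData (T.pureCell h) where
  lc :=
    { cell := fun {X X'} g => squareIso (h ▷ X.of) (h ▷ X'.of) (rightCell_pure h X.of)
        (rightCell_pure h X'.of)
        ((T.functor.obj (OneCell.grade g)).left_central_square h (OneCell.map g))
      naturality := fun _ => TwoCell.ext (swapUnit_naturality _)
      cell_id := fun _ => TwoCell.ext (swapUnit_tensorUnit rfl rfl)
      cell_comp := fun _ _ => TwoCell.ext (swapUnit_tensorObj _ _ rfl rfl) }
  rc :=
    { cell := fun {X X'} g => squareIso (X.of ◁ h) (X'.of ◁ h) (leftCell_pure X.of h)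
        (leftCell_pure X'.of h)
        ((T.functor.obj (OneCell.grade g)).right_central_square h (OneCell.map g))
      naturality := fun _ => TwoCell.ext (swapUnit_naturality _)
      cell_id := fun _ => TwoCell.ext (swapUnit_tensorUnit rfl rfl)
      cell_comp := fun _ _ => TwoCell.ext (swapUnit_tensorObj _ _ rfl rfl) }

/-- The lift of an isomorphism of `C` is an equivalence, with inverse the lift of the inverse. -/
def pureEquiv (T : BistrongGradedMonad E C) {A B : C} (i : A ≅ B) :
    EquivalenceData (T.pureCell i.hom) where
  inv := T.pureCell i.inv
  unit := (triangleIso rfl rfl (Category.id_comp _).symm i.hom_inv_id).symm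
  counit := triangleIso rfl rfl (Category.id_comp _).symm i.inv_hom_id

/-- The structural 2-cells of the premonoidal bicategory `K_T`: the squares are filled by the axioms
of the strengths, and `p`, `m`, `l`, `r` by the coherence identities of `C`. -/
def premonoidalData (T : BistrongGradedMonad E C) : PremonoidalData T.cells where
  lamNat := lamNat T
  lamEquiv A := pureEquiv T (λ_ A.of)
  lamCentral A := pureCentral T (λ_ A.of).hom
  rhoNat := rhoNat T
  rhoEquiv A := pureEquiv T (ρ_ A.of)
  rhoCentral A := pureCentral T (ρ_ A.of).hom
  assocNat₁ := assocNat₁ T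
  assocNat₂ := assocNat₂ T
  assocNat₃ := assocNat₃ T
  assocEquiv A X Y := pureEquiv T (α_ A.of X.of Y.of)
  assocCentral A X Y := pureCentral T (α_ A.of X.of Y.of).hom
  p A X Y Z := pentagonIso (rightCell_pure (α_ A.of X.of Y.of).hom Z.of) rfl
    (leftCell_pure A.of (α_ X.of Y.of Z.of).hom) rfl rfl (pentagon A.of X.of Y.of Z.of)
  m A X := triangleIso rfl (leftCell_pure A.of (λ_ X.of).hom) (rightCell_pure (ρ_ A.of).hom X.of)
    (triangle A.of X.of)
  l A X := (triangleIso rfl rfl (rightCell_pure (λ_ A.of).hom X.of)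
    (leftUnitor_tensor A.of X.of)).symm
  r A X := (triangleIso rfl (leftCell_pure A.of (ρ_ X.of).hom) rfl
    (rightUnitor_tensor A.of X.of)).symm

/-! ### The modification and monoidal bicategory equations -/

@[simp]
theorem grade_assoc (A X Y : T.Kleisli) : OneCell.grade (T.cells.assoc A X Y) = 𝟙_ E := rfl

@[simp]
theorem grade_lam (A : T.Kleisli) : OneCell.grade (T.cells.lam A) = 𝟙_ E := rfl

@[simp]
theorem grade_rho (A : T.Kleisli) : OneCell.grade (T.cells.rho A) = 𝟙_ E := rfl

@[simp]
theorem gr_p (A X Y Z : T.Kleisli) :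
    TwoCell.gr ((premonoidalData T).p A X Y Z).hom = 𝟙_ E ◁ (λ_ (𝟙_ E)).hom := rfl

@[simp]
theorem gr_m (A X : T.Kleisli) :
    TwoCell.gr ((premonoidalData T).m A X).hom = (λ_ (𝟙_ E)).hom := rfl

@[simp]
theorem gr_l_inv (A X : T.Kleisli) :
    TwoCell.gr ((premonoidalData T).l A X).inv = (λ_ (𝟙_ E)).hom := rfl

@[simp]
theorem gr_r_inv (A X : T.Kleisli) :
    TwoCell.gr ((premonoidalData T).r A X).inv = (λ_ (𝟙_ E)).hom := rfl

@[simp]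
theorem gr_assoc₁ {A A' : T.Kleisli} (f : A ⟶ A') (X Y : T.Kleisli) :
    TwoCell.gr ((premonoidalData T).assoc₁ f X Y).hom =
      (ρ_ (OneCell.grade f)).hom ≫ (λ_ (OneCell.grade f)).inv := rfl

@[simp]
theorem gr_assoc₂ (A : T.Kleisli) {X X' : T.Kleisli} (f : X ⟶ X') (Y : T.Kleisli) :
    TwoCell.gr ((premonoidalData T).assoc₂ A f Y).hom =
      (ρ_ (OneCell.grade f)).hom ≫ (λ_ (OneCell.grade f)).inv := rfl

@[simp]
theorem gr_assoc₂_inv (A : T.Kleisli) {X X' : T.Kleisli} (f : X ⟶ X') (Y : T.Kleisli) :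
    TwoCell.gr ((premonoidalData T).assoc₂ A f Y).inv =
      (λ_ (OneCell.grade f)).hom ≫ (ρ_ (OneCell.grade f)).inv := rfl

@[simp]
theorem gr_assoc₃_inv (A X : T.Kleisli) {Y Y' : T.Kleisli} (f : Y ⟶ Y') :
    TwoCell.gr ((premonoidalData T).assoc₃ A X f).inv =
      (λ_ (OneCell.grade f)).hom ≫ (ρ_ (OneCell.grade f)).inv := rfl

open Bicategory in
@[simp]
theorem gr_bicategoricalComp {A B : T.Kleisli} {f g h i : A ⟶ B} [BicategoricalCoherence g h]
    (η : f ⟶ g) (θ : h ⟶ i) :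
    TwoCell.gr (η ⊗≫ θ) =
      TwoCell.gr η ≫ TwoCell.gr (BicategoricalCoherence.iso (f := g) (g := h)).hom ≫ TwoCell.gr θ :=
  rfl

@[simp]
theorem gr_mapSq_left (A : T.Kleisli) {a a' b b' : T.Kleisli} {p : a ⟶ a'} {q : b ⟶ b'} {x : a ⟶ b}
    {x' : a' ⟶ b'} (N : p ≫ x' ≅ x ≫ q) :
    TwoCell.gr (mapSq (leftAct A) N).hom = TwoCell.gr N.hom :=
  (Category.id_comp _).trans (Category.comp_id _)

@[simp]
theorem gr_mapSq_right (A : T.Kleisli) {a a' b b' : T.Kleisli} {p : a ⟶ a'} {q : b ⟶ b'}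
    {x : a ⟶ b} {x' : a' ⟶ b'} (N : p ≫ x' ≅ x ≫ q) :
    TwoCell.gr (mapSq (rightAct A) N).hom = TwoCell.gr N.hom :=
  (Category.id_comp _).trans (Category.comp_id _)

@[simp]
theorem gr_map21_left (A : T.Kleisli) {a b c : T.Kleisli} {x : a ⟶ b} {y : b ⟶ c} {z : a ⟶ c}
    (N : x ≫ y ≅ z) : TwoCell.gr (map21 (leftAct A) N).hom = TwoCell.gr N.hom :=
  Category.id_comp _

@[simp]
theorem gr_map21_right (A : T.Kleisli) {a b c : T.Kleisli} {x : a ⟶ b} {y : b ⟶ c} {z : a ⟶ c}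
    (N : x ≫ y ≅ z) : TwoCell.gr (map21 (rightAct A) N).hom = TwoCell.gr N.hom :=
  Category.id_comp _

@[simp]
theorem gr_map32_left (A : T.Kleisli) {a b b' c d : T.Kleisli} {x : a ⟶ b} {y : b ⟶ c} {z : c ⟶ d}
    {x' : a ⟶ b'} {y' : b' ⟶ d} (N : x ≫ (y ≫ z) ≅ x' ≫ y') :
    TwoCell.gr (map32 (leftAct A) N).hom = TwoCell.gr N.hom := by
  have h : TwoCell.gr (map32 (leftAct A) N).hom =
      OneCell.grade x ◁ 𝟙 (OneCell.grade y ⊗ OneCell.grade z) ≫ 𝟙 _ ≫ TwoCell.gr N.hom ≫ 𝟙 _ := rfl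
  refine h.trans ?_
  rw [MonoidalCategory.whiskerLeft_id]
  exact (Category.id_comp _).trans ((Category.id_comp _).trans (Category.comp_id _))

/-- Both actions leave the map of grades of a 2-cell unchanged, so the two sides of this equation
are definitionally those of `gr_map32_left`. -/
@[simp]
theorem gr_map32_right (A : T.Kleisli) {a b b' c d : T.Kleisli} {x : a ⟶ b} {y : b ⟶ c}
    {z : c ⟶ d} {x' : a ⟶ b'} {y' : b' ⟶ d} (N : x ≫ (y ≫ z) ≅ x' ≫ y') :
    TwoCell.gr (map32 (rightAct A) N).hom = TwoCell.gr N.hom :=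
  gr_map32_left A (a := a) (b := b) (b' := b') (c := c) (d := d) N

/-- The modification axioms for `p`. The `nᵢ` stand for the maps of grades of the five naturality
2-cells in the axiom, which are `swapUnit e` only propositionally when the 2-cell is an image under
a pseudofunctor; this covers all four arguments of `p`. -/
theorem p_modification {e : E} {n₁ n₂ n₃ n₄ n₅ : e ⊗ 𝟙_ E ⟶ 𝟙_ E ⊗ e}
    (h₁ : n₁ = swapUnit e) (h₂ : n₂ = swapUnit e) (h₃ : n₃ = swapUnit e) (h₄ : n₄ = swapUnit e)
    (h₅ : n₅ = swapUnit e) :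
    e ◁ 𝟙_ E ◁ (λ_ (𝟙_ E)).hom ≫
      ((α_ e (𝟙_ E) (𝟙_ E)).inv ≫ n₄ ▷ 𝟙_ E ≫ (α_ (𝟙_ E) e (𝟙_ E)).hom ≫
        𝟙_ E ◁ n₅ ≫ (α_ (𝟙_ E) (𝟙_ E) e).inv) =
    ((α_ e (𝟙_ E) (𝟙_ E ⊗ 𝟙_ E)).inv ≫ n₁ ▷ (𝟙_ E ⊗ 𝟙_ E) ≫ (α_ (𝟙_ E) e (𝟙_ E ⊗ 𝟙_ E)).hom ≫
        𝟙_ E ◁ ((α_ e (𝟙_ E) (𝟙_ E)).inv ≫ n₂ ▷ 𝟙_ E ≫ (α_ (𝟙_ E) e (𝟙_ E)).hom ≫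
        𝟙_ E ◁ n₃ ≫ (α_ (𝟙_ E) (𝟙_ E) e).inv) ≫ (α_ (𝟙_ E) (𝟙_ E ⊗ 𝟙_ E) e).inv) ≫
      (𝟙_ E ◁ (λ_ (𝟙_ E)).hom) ▷ e := by
  subst h₁ h₂ h₃ h₄ h₅
  simp only [swapUnit]
  monoidal

/-- The modification axioms for `m`, with the `nᵢ` as in `p_modification`. -/
theorem m_modification {e : E} {n₁ n₂ n₃ : e ⊗ 𝟙_ E ⟶ 𝟙_ E ⊗ e}
    (h₁ : n₁ = swapUnit e) (h₂ : n₂ = swapUnit e) (h₃ : n₃ = swapUnit e) :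
    e ◁ (λ_ (𝟙_ E)).hom ≫ n₃ =
      ((α_ e (𝟙_ E) (𝟙_ E)).inv ≫ n₁ ▷ 𝟙_ E ≫ (α_ (𝟙_ E) e (𝟙_ E)).hom ≫
        𝟙_ E ◁ n₂ ≫ (α_ (𝟙_ E) (𝟙_ E) e).inv) ≫
        (λ_ (𝟙_ E)).hom ▷ e := by
  subst h₁ h₂ h₃
  simp only [swapUnit]
  monoidal

/-- The modification axioms for `l` and for `r`, with the `nᵢ` as in `p_modification`. -/
theorem l_modification {e : E} {n₁ n₂ n₃ : e ⊗ 𝟙_ E ⟶ 𝟙_ E ⊗ e}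
    (h₁ : n₁ = swapUnit e) (h₂ : n₂ = swapUnit e) (h₃ : n₃ = swapUnit e) :
    e ◁ (λ_ (𝟙_ E)).inv ≫ ((α_ e (𝟙_ E) (𝟙_ E)).inv ≫ n₂ ▷ 𝟙_ E ≫ (α_ (𝟙_ E) e (𝟙_ E)).hom ≫
        𝟙_ E ◁ n₃ ≫ (α_ (𝟙_ E) (𝟙_ E) e).inv) =
      n₁ ≫ (λ_ (𝟙_ E)).inv ▷ e := by
  subst h₁ h₂ h₃
  simp only [swapUnit]
  monoidal

/-- The canonical premonoidal structure of `K_T`. After the passage to maps of grades, the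
equations of a monoidal bicategory only involve structural isomorphisms of `E` between tensor powers
of `I`. -/
def premonoidalStructure (T : BistrongGradedMonad E C) : PremonoidalStructure T.cells where
  toPremonoidalData := premonoidalData T
  p_mod₁ _ _ _ _ := TwoCell.ext (p_modification (gr_mapSq_right _ _) rfl rfl rfl rfl)
  p_mod₂ _ _ _ _ _ _ :=
    TwoCell.ext (p_modification (gr_mapSq_right _ _) rfl (gr_mapSq_left _ _) rfl rfl)
  p_mod₃ _ _ _ _ _ _ :=
    TwoCell.ext (p_modification (gr_mapSq_right _ _) rfl (gr_mapSq_left _ _) rfl rfl)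
  p_mod₄ _ _ _ _ _ _ := TwoCell.ext (p_modification rfl rfl (gr_mapSq_left _ _) rfl rfl)
  m_mod₁ _ _ := TwoCell.ext (m_modification rfl rfl (gr_mapSq_right _ _))
  m_mod₂ _ _ _ _ := TwoCell.ext (m_modification rfl (gr_mapSq_left _ _) rfl)
  l_mod₁ _ _ := TwoCell.ext (l_modification (gr_mapSq_right _ _) rfl rfl)
  l_mod₂ _ _ _ _ := TwoCell.ext (l_modification rfl rfl rfl)
  r_mod₁ _ _ := TwoCell.ext (l_modification rfl rfl rfl)
  r_mod₂ _ _ _ _ := TwoCell.ext (l_modification rfl rfl (gr_mapSq_left _ _))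
  cocycle A X Y Z W := by
    refine TwoCell.ext ?_
    -- The coherence isomorphisms hidden in `⊗≫` are unfolded into associators of `E`.
    simp
    monoidal
  norm_left A X Y := by
    refine TwoCell.ext ?_
    simp
    monoidal
  norm_right A X Y := by
    refine TwoCell.ext ?_
    simp
    monoidal

end BistrongGradedMonad

/-! ### Strictness -/

/-- A morphism between two equal objects that is the identity. -/
def IsIdentityHom {X : Type u} [Category.{v} X] {x y : X} (γ : x ⟶ y) : Prop :=
  ∃ h : x = y, γ = eqToHom h

section

open MonoidalCategory

variable {E : Type u} [Category.{v} E]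

theorem IsIdentity.isIdentityHom_hom {x y : E} {φ : x ≅ y} (h : IsIdentity φ) :
    IsIdentityHom φ.hom := by
  obtain ⟨rfl, rfl⟩ := h
  exact ⟨rfl, rfl⟩

theorem IsIdentity.isIdentityHom_inv {x y : E} {φ : x ≅ y} (h : IsIdentity φ) :
    IsIdentityHom φ.inv := by
  obtain ⟨rfl, rfl⟩ := h
  exact ⟨rfl, rfl⟩

theorem IsIdentityHom.comp {x y z : E} {γ : x ⟶ y} {δ : y ⟶ z} (hγ : IsIdentityHom γ)
    (hδ : IsIdentityHom δ) : IsIdentityHom (γ ≫ δ) := by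
  obtain ⟨rfl, rfl⟩ := hγ
  obtain ⟨rfl, rfl⟩ := hδ
  exact ⟨rfl, Category.id_comp _⟩

theorem IsIdentityHom.whiskerLeft [MonoidalCategory E] (e : E) {x y : E} {γ : x ⟶ y}
    (hγ : IsIdentityHom γ) : IsIdentityHom (e ◁ γ) := by
  obtain ⟨rfl, rfl⟩ := hγ
  exact ⟨rfl, MonoidalCategory.whiskerLeft_id _ _⟩

end

namespace BistrongGradedMonad

open MonoidalCategory

variable {E : Type u₁} [Category.{v₁} E] [MonoidalCategory E]
  {C : Type u₂} [Category.{v₂} C] [MonoidalCategory C] {T : BistrongGradedMonad E C}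

/-- An invertible 2-cell whose map of grades is an identity is an identity: the condition on
2-cells then says that the underlying maps of `C` are equal. -/
theorem isIdentity_of_gr {A B : T.Kleisli} {f g : A ⟶ B} (φ : f ≅ g)
    (h : IsIdentityHom (TwoCell.gr φ.hom)) : IsIdentity φ := by
  obtain ⟨h, hγ⟩ := h
  have hc : OneCell.map f ≫ T.tr (TwoCell.gr φ.hom) B.of = OneCell.map g := φ.hom.comm
  rw [hγ] at hc
  have hfg : f = g := by
    obtain ⟨e, f⟩ := f
    obtain ⟨e', g⟩ := g
    obtain rfl : e = e' := h
    exact congrArg (OneCell.mk e)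
      (((congrArg (f ≫ ·) (tr_id T e B.of)).trans (Category.comp_id _)).symm.trans hc)
  subst hfg
  exact ⟨rfl, Iso.ext (TwoCell.ext hγ)⟩

theorem isIdentityHom_swapUnit (hE : IsStrictMonoidal E) (e : E) : IsIdentityHom (swapUnit e) :=
  (hE.rightUnitor e).isIdentityHom_hom.comp (hE.leftUnitor e).isIdentityHom_inv

theorem premonoidalStructure_isCanonical (T : BistrongGradedMonad E C) :
    IsCanonical (premonoidalStructure T) where
  lam _ := rfl
  rho _ := rfl
  assoc₁ _ _ _ := rfl
  assoc₂ _ _ _ _ _ := rfl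
  assoc₃ _ _ _ _ _ := rfl
  lam_lc _ _ _ _ := rfl
  lam_rc _ _ _ _ := rfl
  rho_lc _ _ _ _ := rfl
  rho_rc _ _ _ _ := rfl
  assoc_lc _ _ _ _ _ _ := rfl
  assoc_rc _ _ _ _ _ _ := rfl
  lam_inv _ := rfl
  rho_inv _ := rfl
  assoc_inv _ _ _ := rfl
  p _ _ _ _ := rfl
  m _ _ := rfl
  l _ _ := rfl
  r _ _ := rfl

theorem isIdentity_pureEquiv (hE : IsStrictMonoidal E) {A B : C} (i : A ≅ B) :
    IsIdentity (pureEquiv T i).unit ∧ IsIdentity (pureEquiv T i).counit :=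
  ⟨isIdentity_of_gr _ (hE.leftUnitor _).isIdentityHom_inv,
    isIdentity_of_gr _ (hE.leftUnitor _).isIdentityHom_hom⟩

theorem premonoidalStructure_isStrict (T : BistrongGradedMonad E C) (hE : IsStrictMonoidal E) :
    (premonoidalStructure T).IsStrict where
  left _ := ⟨fun _ => isIdentity_of_gr _ ⟨rfl, rfl⟩, fun _ _ => isIdentity_of_gr _ ⟨rfl, rfl⟩⟩
  right _ := ⟨fun _ => isIdentity_of_gr _ ⟨rfl, rfl⟩, fun _ _ => isIdentity_of_gr _ ⟨rfl, rfl⟩⟩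
  lam _ := isIdentity_of_gr _ (isIdentityHom_swapUnit hE _)
  rho _ := isIdentity_of_gr _ (isIdentityHom_swapUnit hE _)
  assoc₁ _ _ _ := isIdentity_of_gr _ (isIdentityHom_swapUnit hE _)
  assoc₂ _ _ _ _ _ := isIdentity_of_gr _ (isIdentityHom_swapUnit hE _)
  assoc₃ _ _ _ _ _ := isIdentity_of_gr _ (isIdentityHom_swapUnit hE _)
  lam_lc _ _ _ _ := isIdentity_of_gr _ (isIdentityHom_swapUnit hE _)
  lam_rc _ _ _ _ := isIdentity_of_gr _ (isIdentityHom_swapUnit hE _)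
  rho_lc _ _ _ _ := isIdentity_of_gr _ (isIdentityHom_swapUnit hE _)
  rho_rc _ _ _ _ := isIdentity_of_gr _ (isIdentityHom_swapUnit hE _)
  assoc_lc _ _ _ _ _ _ := isIdentity_of_gr _ (isIdentityHom_swapUnit hE _)
  assoc_rc _ _ _ _ _ _ := isIdentity_of_gr _ (isIdentityHom_swapUnit hE _)
  lam_equiv _ := isIdentity_pureEquiv hE _
  rho_equiv _ := isIdentity_pureEquiv hE _
  assoc_equiv _ _ _ := isIdentity_pureEquiv hE _
  p _ _ _ _ := isIdentity_of_gr _ ((hE.leftUnitor _).isIdentityHom_hom.whiskerLeft _)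
  m _ _ := isIdentity_of_gr _ (hE.leftUnitor _).isIdentityHom_hom
  l _ _ := isIdentity_of_gr _ (hE.leftUnitor _).isIdentityHom_inv
  r _ _ := isIdentity_of_gr _ (hE.leftUnitor _).isIdentityHom_inv

end BistrongGradedMonad

theorem mainTheorem12 {E : Type u₁} [Category.{v₁} E] [MonoidalCategory E]
    {C : Type u₂} [Category.{v₂} C] [MonoidalCategory C] (T : BistrongGradedMonad E C) :
    ∃ P : PremonoidalStructure T.cells,
      BistrongGradedMonad.IsCanonical P ∧ (IsStrictMonoidal E → P.IsStrict) :=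
  ⟨BistrongGradedMonad.premonoidalStructure T,
    BistrongGradedMonad.premonoidalStructure_isCanonical T,
    BistrongGradedMonad.premonoidalStructure_isStrict T⟩
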